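/- Let $n\ge 2$, let $G_0$ be the self-adjoint realization of $-\Delta$ on $L^2(\mathbb R^n)$, let $\langle x\rangle=(1+|x|^2)^{1/2}$, and let $\varphi\in C_0^\infty((0,+\infty))$. For $t\in\mathbb R$ and $0<h\le 1$ the operator $e^{it\sqrt{G_0}}\varphi(h\sqrt{G_0})$ is defined on $L^2(\mathbb R^n)$ by the functional calculus of $G_0$, and on $L^1(\mathbb R^n)$ as the unique bounded operator $L^1\to L^\infty$ which coincides with it on $L^1\cap L^2$; this extension exists for every $t\in\mathbb R$ and $0<h\le 1$. For every $0\le s\le (n-1)/2$ and every $\epsilon>0$ there is a constant $C>0$ such that for all $0<h\le 1$ the following estimates hold: $$\left\|\langle x\rangle^{-s}e^{it\sqrt{G_0}}\varphi(h\sqrt{G_0})\langle x\rangle^{-s}\right\|_{L^2\to L^2}\le C\langle t\rangle^{-s},\qquad \forall t\in\mathbb R,$$ $$\left\|e^{it\sqrt{G_0}}\varphi(h\sqrt{G_0})\right\|_{L^1\to L^\infty}\le Ch^{-(n+1)/2}|t|^{-(n-1)/2},\qquad \forall t\neq 0,$$ $$\left\|e^{it\sqrt{G_0}}\varphi(h\sqrt{G_0})\langle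 x\rangle^{-1/2-s-\epsilon}\right\|_{L^2\to L^\infty}\le Ch^{-(n+1)/2}|t|^{-s},\qquad \forall t\neq 0,$$ $$\int_{-\infty}^\infty|t|^{2s}\left\|\langle x\rangle^{-1/2-s-\epsilon}e^{it\sqrt{G_0}}\varphi(h\sqrt{G_0})f\right\|_{L^2}^2\,dt\le Ch^{-n}\|f\|_{L^1}^2,\qquad \forall f\in L^1(\mathbb R^n).$$ The constant $C$ is independent of $t$, $h$ and $f$. -/

import Mathlib

open MeasureTheory FourierTransform
open scoped ENNReal ContDiff

noncomputable section

namespace FreeWave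

/-- `ℝⁿ` with its Euclidean norm and Lebesgue measure. -/
abbrev Eucl (n : ℕ) : Type := EuclideanSpace ℝ (Fin n)

/-- The complex space `L^p(ℝⁿ)`. -/
abbrev LpR (n : ℕ) (p : ℝ≥0∞) : Type := Lp (α := Eucl n) ℂ p volume

/-- `⟨x⟩ = (1 + |x|²)^{1/2}`, on `ℝⁿ` and (for the time variable) on `ℝ`. -/
def bracket {V : Type*} [NormedAddCommGroup V] (x : V) : ℝ := Real.sqrt (1 + ‖x‖ ^ 2)

/-- The bounded operator of multiplication by an essentially bounded function `m` on
`L²(ℝⁿ)`. -/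
def mulOp {n : ℕ} (m : Eucl n → ℂ) (hm : MemLp m ∞ volume) : LpR n 2 →L[ℂ] LpR n 2 :=
  (ContinuousLinearMap.mul ℂ ℂ).holderL volume ∞ 2 2 (hm.toLp m)

/-- The bounded Fourier multiplier `𝓕⁻¹ m(ξ) 𝓕` on `L²(ℝⁿ)`. -/
def fourierMul {n : ℕ} (m : Eucl n → ℂ) (hm : MemLp m ∞ volume) : LpR n 2 →L[ℂ] LpR n 2 :=
  ((Lp.fourierTransformₗᵢ (Eucl n) ℂ).symm : LpR n 2 →L[ℂ] LpR n 2) ∘L mulOp m hm ∘L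
    ((Lp.fourierTransformₗᵢ (Eucl n) ℂ) : LpR n 2 →L[ℂ] LpR n 2)

theorem memLp_symbol (n : ℕ) {F : ℝ → ℂ} (hF : Measurable F) (hb : ∃ M, ∀ l, ‖F l‖ ≤ M) :
    MemLp (fun ξ : Eucl n => F ((2 * Real.pi * ‖ξ‖) ^ 2)) ∞ volume := by
  obtain ⟨M, hM⟩ := hb
  exact memLp_top_of_bound (hF.comp (by fun_prop)).aestronglyMeasurable M
    (Filter.Eventually.of_forall fun ξ => hM _)

/-- The functional calculus `F ↦ F(G₀)`, for bounded Borel functions `F`, of the self-adjoint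
realization `G₀` of `-Δ` on `L²(ℝⁿ)`. With the normalization
`𝓕 f(ξ) = ∫ e^{-2πi⟨x,ξ⟩} f(x) dx`, the Fourier transform turns `G₀` into multiplication by
`(2π|ξ|)²`. -/
def calcG₀ (n : ℕ) (F : ℝ → ℂ) (hF : Measurable F) (hb : ∃ M, ∀ l, ‖F l‖ ≤ M) :
    LpR n 2 →L[ℂ] LpR n 2 :=
  fourierMul (fun ξ : Eucl n => F ((2 * Real.pi * ‖ξ‖) ^ 2)) (memLp_symbol n hF hb)

section Resolvent

open TemperedDistribution Laplacian
open scoped SchwartzMap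

theorem fourierMul_toTemperedDistribution {n : ℕ} {g : Eucl n → ℂ} (hg : g.HasTemperateGrowth)
    (hm : MemLp g ∞ volume) (v : LpR n 2) :
    ((fourierMul g hm v : LpR n 2) : 𝓢'(Eucl n, ℂ)) =
      fourierMultiplierCLM ℂ g (v : 𝓢'(Eucl n, ℂ)) := by
  rw [fourierMultiplierCLM_apply, Lp.fourier_toTemperedDistribution_eq,
    ← Lp.toTemperedDistribution_smul_eq (p := ∞) (q := 2) (r := 2) hg hm,
    Lp.fourierInv_toTemperedDistribution_eq]
  rfl

/-- The operator `F(G₀)` with `F(l) = (1 + l)⁻¹` on `[0, ∞)` is the resolvent `(1 + G₀)⁻¹`: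
`u = F(G₀) v` solves `u - Δu = v` in the sense of distributions, for every `v ∈ L²`. -/
theorem calcG₀_resolvent (n : ℕ) (hF : Measurable fun l : ℝ => ((1 + |l| : ℝ) : ℂ)⁻¹)
    (hb : ∃ M, ∀ l : ℝ, ‖((1 + |l| : ℝ) : ℂ)⁻¹‖ ≤ M) (v : LpR n 2) :
    (calcG₀ n _ hF hb v : 𝓢'(Eucl n, ℂ)) - Δ (calcG₀ n _ hF hb v : 𝓢'(Eucl n, ℂ)) = v := by
  have e : (fun ξ : Eucl n => ((1 + |(2 * Real.pi * ‖ξ‖) ^ 2| : ℝ) : ℂ)⁻¹) =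
      fun ξ => (((1 + ‖(2 * Real.pi) • ξ‖ ^ 2) ^ (-1 : ℝ) : ℝ) : ℂ) := by
    ext ξ
    rw [Real.rpow_neg_one, norm_smul, abs_of_nonneg (sq_nonneg _), Complex.ofReal_inv,
      Real.norm_of_nonneg (by positivity)]
  have h1 : (fun ξ : Eucl n => (((1 + ‖ξ‖ ^ 2) ^ (-1 : ℝ) : ℝ) : ℂ)).HasTemperateGrowth := by
    fun_prop
  have h2 : (fun ξ : Eucl n => (2 * Real.pi) • ξ).HasTemperateGrowth := by
    exact ((2 * Real.pi) • ContinuousLinearMap.id ℝ (Eucl n)).hasTemperateGrowth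
  have hg : (fun ξ : Eucl n => ((1 + |(2 * Real.pi * ‖ξ‖) ^ 2| : ℝ) : ℂ)⁻¹).HasTemperateGrowth := by
    rw [e]; exact h1.comp h2
  have h3 : (fun x : Eucl n ↦ Complex.ofReal (‖x‖ ^ 2)).HasTemperateGrowth := by fun_prop
  have h4 : (((-(2 * Real.pi) ^ 2 : ℝ) : ℂ) • ((fun ξ : Eucl n =>
      ((1 + |(2 * Real.pi * ‖ξ‖) ^ 2| : ℝ) : ℂ)⁻¹) *
        fun x => Complex.ofReal (‖x‖ ^ 2))).HasTemperateGrowth :=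
    (Function.HasTemperateGrowth.const ((-(2 * Real.pi) ^ 2 : ℝ) : ℂ)).mul (hg.mul h3)
  unfold calcG₀
  rw [fourierMul_toTemperedDistribution hg, laplacian_eq_fourierMultiplierCLM,
    fourierMultiplierCLM_fourierMultiplierCLM_apply hg h3]
  rw [← Complex.coe_smul, fourierMultiplierCLM_apply, fourierMultiplierCLM_apply,
    ← FourierTransform.fourierInv_smul, ← _root_.smul_apply, ← smulLeftCLM_smul (hg.mul h3),
    ← FourierTransform.fourierInvCLM_apply (R := ℂ), ← FourierTransform.fourierInvCLM_apply (R := ℂ),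
    ← map_sub, ← _root_.sub_apply,
    ← smulLeftCLM_sub hg h4]
  have e1 : ((fun ξ : Eucl n => ((1 + |(2 * Real.pi * ‖ξ‖) ^ 2| : ℝ) : ℂ)⁻¹) -
      ((-(2 * Real.pi) ^ 2 : ℝ) : ℂ) • ((fun ξ : Eucl n =>
        ((1 + |(2 * Real.pi * ‖ξ‖) ^ 2| : ℝ) : ℂ)⁻¹) * fun x => Complex.ofReal (‖x‖ ^ 2))) =
      fun _ => 1 := by
    ext ξ
    have : ((1 + (2 * Real.pi * ‖ξ‖) ^ 2 : ℝ) : ℂ) ≠ 0 := by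
      exact_mod_cast (by positivity : (0 : ℝ) < 1 + (2 * Real.pi * ‖ξ‖) ^ 2).ne'
    simp only [Pi.sub_apply, Pi.smul_apply, Pi.mul_apply, smul_eq_mul,
      abs_of_nonneg (sq_nonneg (2 * Real.pi * ‖ξ‖))]
    push_cast at this ⊢
    linear_combination inv_mul_cancel₀ this
  rw [e1, smulLeftCLM_const, one_smul, FourierTransform.fourierInvCLM_apply,
    FourierTransform.fourierInv_fourier_eq]

end Resolvent

/-- The function `l ↦ e^{it√l} φ(h√l)`. -/
def waveFun (φ : ℝ → ℂ) (t h : ℝ) (l : ℝ) : ℂ :=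
  Complex.exp (Complex.I * (t * Real.sqrt l : ℝ)) * φ (h * Real.sqrt l)

theorem measurable_waveFun {φ : ℝ → ℂ} (hφ : Continuous φ) (t h : ℝ) :
    Measurable (waveFun φ t h) := by
  unfold waveFun
  exact Continuous.measurable (by fun_prop)

theorem bounded_waveFun {φ : ℝ → ℂ} (hφ : Continuous φ) (hc : HasCompactSupport φ) (t h : ℝ) :
    ∃ M, ∀ l, ‖waveFun φ t h l‖ ≤ M := by
  obtain ⟨M, hM⟩ := hφ.bounded_above_of_compact_support hc
  refine ⟨M, fun l => ?_⟩
  unfold waveFun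
  rw [norm_mul, mul_comm Complex.I, Complex.norm_exp_ofReal_mul_I, one_mul]
  exact hM _

/-- The operator `e^{it√G₀} φ(h√G₀)` on `L²(ℝⁿ)`. -/
def wave (n : ℕ) (φ : ℝ → ℂ) (hφ : Continuous φ) (hc : HasCompactSupport φ) (t h : ℝ) :
    LpR n 2 →L[ℂ] LpR n 2 :=
  calcG₀ n (waveFun φ t h) (measurable_waveFun hφ t h) (bounded_waveFun hφ hc t h)

theorem one_le_bracket {V : Type*} [NormedAddCommGroup V] (x : V) : 1 ≤ bracket x :=
  Real.one_le_sqrt.2 (by nlinarith [sq_nonneg ‖x‖])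

theorem memLp_weight (n : ℕ) {a : ℝ} (ha : 0 ≤ a) :
    MemLp (fun x : Eucl n => ((bracket x ^ (-a) : ℝ) : ℂ)) ∞ volume := by
  refine memLp_top_of_bound (C := 1) ?_ (Filter.Eventually.of_forall fun x => ?_)
  · unfold bracket
    exact Measurable.aestronglyMeasurable (by fun_prop)
  · rw [Complex.norm_real, Real.norm_of_nonneg
      (Real.rpow_nonneg (zero_le_one.trans (one_le_bracket x)) _)]
    exact Real.rpow_le_one_of_one_le_of_nonpos (one_le_bracket x) (by linarith)

/-- Multiplication by `⟨x⟩^{-a}` on `L²(ℝⁿ)`, for `a ≥ 0`. -/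
def weight (n : ℕ) (a : ℝ) (ha : 0 ≤ a) : LpR n 2 →L[ℂ] LpR n 2 :=
  mulOp (fun x : Eucl n => ((bracket x ^ (-a) : ℝ) : ℂ)) (memLp_weight n ha)

/-- `U` is the bounded operator `L¹ → L^∞` that coincides with `T` on `L¹ ∩ L²`. As `L¹ ∩ L²` is
dense in `L¹`, there is at most one such `U`. -/
def IsExtension {n : ℕ} (T : LpR n 2 →L[ℂ] LpR n 2) (U : LpR n 1 →L[ℂ] LpR n ∞) : Prop :=
  ∀ (f : Eucl n → ℂ) (h1 : MemLp f 1 volume) (h2 : MemLp f 2 volume),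
    (U (h1.toLp f) : Eucl n → ℂ) =ᵐ[volume] (T (h2.toLp f) : Eucl n → ℂ)

end FreeWave

end

/-!
The kernel of `e^{it√G₀} φ(h√G₀)` is radial; in polar coordinates it is, as a function of `t`, the
one-dimensional inverse Fourier transform of a profile `r ↦ φ(h r) r^{n-1} σ̂(r x)`, with `σ` the
surface measure of the unit sphere, and scaling reduces every bound to `h = 1`. The function `σ̂`
solves a Bessel equation, which gives its decay `|y|^{-(n-1)/2}`, hence
`|t|^s |x|^{(n-1)/2-s} |K_t(x)| ≤ C` for `|t|` comparable to `|x|`; away from the light cone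
`|t| = |x|` the smoothness of `φ` gives rapid decay.

The case `s = (n-1)/2` of the weighted bound is the dispersive estimate. The `L² → L^∞` estimate
follows by Cauchy–Schwarz, and the space-time estimate by Plancherel in `t`, as
`∫ ⟨y⟩^{-2a} |x-y|^{2s-(n-1)} dy` is bounded in `x` for `a > 1/2 + s`. For the local decay one
splits `L²` at `|x| = |t|/4`: outside, the weight gains `⟨t⟩^{-s}`; inside, `|x - y| ≤ |t|/2` stays
away from the light cone.
-/

noncomputable section

namespace FreeWave

section Fourier

open scoped SchwartzMap

variable {E : Type*} [NormedAddCommGroup E] [InnerProductSpace ℝ E] [FiniteDimensional ℝ E]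
  [MeasurableSpace E] [BorelSpace E]

theorem continuous_fourierInv {f : E → ℂ} (hf : Integrable f) : Continuous (𝓕⁻ f) := by
  have h : Continuous (𝓕 f) :=
    VectorFourier.fourierIntegral_continuous Real.continuous_fourierChar
      (L := innerₗ E) continuous_inner hf
  exact (h.comp continuous_neg).congr fun x => (Real.fourierInv_eq_fourier_neg f x).symm

theorem integral_fourierInv_mul_eq {f g : E → ℂ} (hf : Integrable f) (hg : Integrable g) :
    ∫ x, 𝓕⁻ f x * g x = ∫ x, f x * 𝓕⁻ g x := by
  have h := VectorFourier.integral_fourierIntegral_smul_eq_flip (L := innerₗ E) (μ := volume)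
    (ν := volume) Real.continuous_fourierChar continuous_inner hf hg.comp_neg
  rw [flip_innerₗ] at h
  rw [← integral_neg_eq_self, Real.fourierInv_eq_fourier_comp_neg g]
  simp only [Real.fourierInv_eq_fourier_neg, neg_neg]
  exact h

theorem fourierInv_toLp_ae_eq {f : E → ℂ} (h1 : MemLp f 1) (h2 : MemLp f 2) :
    (𝓕⁻ (h2.toLp f : Lp ℂ 2 (volume : Measure E)) : Lp ℂ 2 (volume : Measure E))
      =ᵐ[volume] 𝓕⁻ f := by
  have hf := memLp_one_iff_integrable.1 h1
  refine ae_eq_of_integral_contDiff_smul_eq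
    ((Lp.memLp _).locallyIntegrable one_le_two)
    (continuous_fourierInv hf).locallyIntegrable fun g hg hgc => ?_
  have hgc' : HasCompactSupport fun x => (g x : ℂ) := hgc.comp_left Complex.ofReal_zero
  let G : 𝓢(E, ℂ) := hgc'.toSchwartzMap (Complex.ofRealCLM.contDiff.comp hg)
  let u : Lp ℂ 2 (volume : Measure E) := h2.toLp f
  have hdual : ((𝓕⁻ u : Lp ℂ 2 (volume : Measure E)) : 𝓢'(E, ℂ)) G = (u : 𝓢'(E, ℂ)) (𝓕⁻ G) := by
    rw [← Lp.fourierInv_toTemperedDistribution_eq]; rfl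
  have hright : ∫ x, 𝓕⁻ G x • u x = ∫ x, 𝓕⁻ (G : E → ℂ) x * f x := by
    refine integral_congr_ae ?_
    filter_upwards [h2.coeFn_toLp] with x hx
    rw [hx, SchwartzMap.fourierInv_coe, smul_eq_mul]
  rw [Lp.toTemperedDistribution_apply, Lp.toTemperedDistribution_apply, hright,
    integral_fourierInv_mul_eq G.integrable hf] at hdual
  exact hdual

theorem eLpNorm_fourierInv_eq {f : E → ℂ} (h1 : MemLp f 1) (h2 : MemLp f 2) :
    eLpNorm (𝓕⁻ f) 2 = eLpNorm f 2 := by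
  have h := (Lp.fourierTransformₗᵢ E ℂ).symm.norm_map (h2.toLp f)
  rw [Lp.norm_def, Lp.norm_def, ENNReal.toReal_eq_toReal_iff' (Lp.eLpNorm_ne_top _)
    (Lp.eLpNorm_ne_top _)] at h
  rw [← eLpNorm_congr_ae (fourierInv_toLp_ae_eq h1 h2), ← eLpNorm_congr_ae h2.coeFn_toLp]
  exact h

theorem fourierInv_conj_fourierChar_mul (m : E → ℂ) (x y : E) :
    𝓕⁻ (fun ξ => (starRingEnd ℂ) (Real.fourierChar (inner ℝ ξ x) * m ξ)) y =
      (starRingEnd ℂ) (𝓕⁻ m (x - y)) := by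
  rw [Real.fourierInv_eq, Real.fourierInv_eq, ← integral_conj]
  congr 1 with ξ
  rw [inner_sub_right, sub_eq_add_neg, AddChar.map_add_eq_mul, AddChar.map_neg_eq_inv]
  simp only [Circle.smul_def, smul_eq_mul, map_mul, Circle.coe_mul, Circle.coe_inv_eq_conj,
    Complex.conj_conj]
  ring

/-- Parseval's identity for `f` and `ξ ↦ conj (e^{2πi⟨ξ, x⟩} m(ξ))`. -/
theorem fourierInv_mul_fourier_eq_convolution {m : E → ℂ} (h1 : MemLp m 1) (h2 : MemLp m 2)
    (f : Lp ℂ 2 (volume : Measure E)) (x : E) :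
    𝓕⁻ (fun ξ => m ξ * (𝓕 f : Lp ℂ 2 (volume : Measure E)) ξ) x = ∫ y, 𝓕⁻ m (x - y) * f y := by
  let a : E → ℂ := fun ξ => (starRingEnd ℂ) (Real.fourierChar (inner ℝ ξ x) * m ξ)
  have hnorm : ∀ᵐ ξ, ‖a ξ‖ ≤ ‖m ξ‖ := .of_forall fun ξ => by
    rw [RCLike.norm_conj, norm_mul, Circle.norm_coe, one_mul]
  have hchar : Continuous fun ξ : E => (Real.fourierChar (inner ℝ ξ x) : ℂ) := by fun_prop
  have hmeas : AEStronglyMeasurable a volume :=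
    Complex.continuous_conj.comp_aestronglyMeasurable (hchar.aestronglyMeasurable.mul h1.1)
  have ha1 : MemLp a 1 volume := h1.of_le hmeas hnorm
  have ha2 : MemLp a 2 volume := h2.of_le hmeas hnorm
  let A : Lp ℂ 2 (volume : Measure E) := ha2.toLp a
  have hparseval : inner ℂ (𝓕⁻ A) f = inner ℂ A (𝓕 f) := by
    rw [← Lp.inner_fourier_eq, FourierTransform.fourier_fourierInv_eq]
  rw [L2.inner_def, L2.inner_def] at hparseval
  calc 𝓕⁻ (fun ξ => m ξ * (𝓕 f : Lp ℂ 2 (volume : Measure E)) ξ) x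
      = ∫ ξ, inner ℂ (A ξ) ((𝓕 f : Lp ℂ 2 (volume : Measure E)) ξ) := by
        rw [Real.fourierInv_eq]
        refine integral_congr_ae ?_
        filter_upwards [ha2.coeFn_toLp] with ξ hξ
        rw [hξ, RCLike.inner_apply, Complex.conj_conj, Circle.smul_def, smul_eq_mul]
        ring
    _ = ∫ y, inner ℂ ((𝓕⁻ A : Lp ℂ 2 (volume : Measure E)) y) (f y) := hparseval.symm
    _ = ∫ y, 𝓕⁻ m (x - y) * f y := by
        refine integral_congr_ae ?_
        filter_upwards [fourierInv_toLp_ae_eq ha1 ha2] with y hy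
        rw [hy, fourierInv_conj_fourierChar_mul, RCLike.inner_apply, Complex.conj_conj, mul_comm]

end Fourier

theorem mulOp_ae_eq {n : ℕ} {m : Eucl n → ℂ} (hm : MemLp m ∞) (f : LpR n 2) :
    mulOp m hm f =ᵐ[volume] fun x => m x * f x := by
  refine ((ContinuousLinearMap.mul ℂ ℂ).coeFn_holder (hm.toLp m) f).trans ?_
  filter_upwards [hm.coeFn_toLp] with x hx
  rw [hx, ContinuousLinearMap.mul_apply']

theorem fourierMul_ae_eq_convolution {n : ℕ} {m : Eucl n → ℂ} (hm : MemLp m ∞)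
    (h1 : MemLp m 1) (h2 : MemLp m 2) (f : LpR n 2) :
    fourierMul m hm f =ᵐ[volume] fun x => ∫ y, 𝓕⁻ m (x - y) * f y := by
  have hprod := mulOp_ae_eq hm (𝓕 f)
  have hmem2 : MemLp (fun ξ => m ξ * (𝓕 f : LpR n 2) ξ) 2 :=
    (memLp_congr_ae hprod).1 (Lp.memLp _)
  have hmem1 : MemLp (fun ξ => m ξ * (𝓕 f : LpR n 2) ξ) 1 := (Lp.memLp _).mul h2
  have heq : fourierMul m hm f = 𝓕⁻ (hmem2.toLp _ : LpR n 2) :=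
    congrArg (fun u : LpR n 2 => (𝓕⁻ u : LpR n 2))
      (Lp.ext (hprod.trans hmem2.coeFn_toLp.symm))
  rw [heq]
  filter_upwards [fourierInv_toLp_ae_eq hmem1 hmem2] with x hx
  rw [hx, fourierInv_mul_fourier_eq_convolution h1 h2]

section Polar

open Metric Set Module

variable {E : Type*} [NormedAddCommGroup E] [InnerProductSpace ℝ E]

/-- The cosine of the angle between the vector `η` and the unit vector `e`; it is `0` at `η = 0`. -/
def dirCos (e η : E) : ℝ := inner ℝ η e / ‖η‖

theorem abs_dirCos_le_one {e : E} (he : ‖e‖ ≤ 1) (η : E) : |dirCos e η| ≤ 1 := by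
  rw [dirCos, abs_div, abs_norm]
  refine div_le_one_of_le₀ ((abs_real_inner_le_norm η e).trans ?_) (norm_nonneg _)
  exact mul_le_of_le_one_right (norm_nonneg _) he

theorem abs_inner_sphere_le {e : E} (he : ‖e‖ ≤ 1) (ν : sphere (0 : E) 1) :
    |inner ℝ ν.1 e| ≤ 1 := by
  simpa only [dirCos, norm_eq_of_mem_sphere, div_one] using abs_dirCos_le_one he ν.1

theorem dirCos_smul_sphere (e : E) {r : ℝ} (hr : 0 < r) (ν : sphere (0 : E) 1) :
    dirCos e (r • ν.1) = inner ℝ ν.1 e := by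
  rw [dirCos, real_inner_smul_left, norm_smul, norm_eq_of_mem_sphere, Real.norm_of_nonneg hr.le,
    mul_one, mul_div_cancel_left₀ _ hr.ne']

theorem hasDerivAt_norm_add_smul (e : E) {η : E} (hη : η ≠ 0) :
    HasDerivAt (fun s : ℝ => ‖η + s • e‖) (dirCos e η) 0 := by
  have hline : HasDerivAt (fun s : ℝ => η + s • e) e 0 := by
    simpa using ((hasDerivAt_id (0 : ℝ)).smul_const e).const_add η
  have hsqrt := hline.norm_sq.sqrt (by simpa using hη)
  simp only [Real.sqrt_sq (norm_nonneg _), zero_smul, add_zero] at hsqrt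
  exact hsqrt.congr_deriv (mul_div_mul_left _ _ two_ne_zero)

theorem hasDerivAt_dirCos_add_smul {e η : E} (he : ‖e‖ = 1) (hη : η ≠ 0) :
    HasDerivAt (fun s : ℝ => dirCos e (η + s • e)) ((1 - dirCos e η ^ 2) / ‖η‖) 0 := by
  have hη' : ‖η‖ ≠ 0 := norm_ne_zero_iff.2 hη
  have hinner : HasDerivAt (fun s : ℝ => inner ℝ (η + s • e) e) 1 0 := by
    simpa [inner_add_left, real_inner_smul_left, he] using
      (hasDerivAt_id (0 : ℝ)).const_add (inner ℝ η e)
  have hdiv := hinner.div (hasDerivAt_norm_add_smul e hη) (by simpa using hη)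
  simp only [zero_smul, add_zero] at hdiv
  refine hdiv.congr_deriv ?_
  rw [dirCos]
  field_simp

theorem hasLineDerivAt_radial_mul_dirCos {e η : E} (he : ‖e‖ = 1) (hη : η ≠ 0) {f g : ℝ → ℂ}
    {f' g' : ℂ} (hf : HasDerivAt f f' ‖η‖) (hg : HasDerivAt g g' (dirCos e η)) :
    HasLineDerivAt ℝ (fun ξ => f ‖ξ‖ * g (dirCos e ξ))
      (f' * (dirCos e η * g (dirCos e η)) +
        f ‖η‖ / ‖η‖ * (g' * (1 - (dirCos e η : ℂ) ^ 2))) η e := by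
  have hfs : HasDerivAt (fun s : ℝ => f ‖η + s • e‖) (dirCos e η • f') 0 :=
    HasDerivAt.scomp (0 : ℝ) (by simpa using hf) (hasDerivAt_norm_add_smul e hη)
  have hgs : HasDerivAt (fun s : ℝ => g (dirCos e (η + s • e)))
      (((1 - dirCos e η ^ 2) / ‖η‖ : ℝ) • g') 0 :=
    HasDerivAt.scomp (0 : ℝ) (by simpa using hg) (hasDerivAt_dirCos_add_smul he hη)
  refine (hfs.mul hgs).congr_deriv ?_
  simp only [zero_smul, add_zero, Complex.real_smul]
  push_cast
  ring

variable [FiniteDimensional ℝ E] [MeasurableSpace E] [BorelSpace E]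

theorem measurable_dirCos (e : E) : Measurable (dirCos e) := by
  unfold dirCos
  fun_prop

theorem integrable_sphere {F : Type*} [NormedAddCommGroup F] {f : ℝ → F} (hf : Continuous f)
    (e : E) :
    Integrable (fun ν : sphere (0 : E) 1 => f (inner ℝ ν.1 e)) (volume : Measure E).toSphere :=
  Continuous.integrable_of_hasCompactSupport (by fun_prop) (.of_compactSpace _)

theorem integral_volumeIoiPow {F : Type*} [NormedAddCommGroup F] [NormedSpace ℝ F] (k : ℕ)
    (f : ℝ → F) :
    ∫ r : Ioi (0 : ℝ), f r ∂(Measure.volumeIoiPow k) = ∫ r in Ioi (0 : ℝ), r ^ k • f r := by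
  simp only [Measure.volumeIoiPow, ENNReal.ofReal]
  rw [integral_withDensity_eq_integral_smul (by fun_prop),
    integral_subtype_comap measurableSet_Ioi fun r => Real.toNNReal (r ^ k) • f r]
  refine setIntegral_congr_fun measurableSet_Ioi fun r hr => ?_
  rw [NNReal.smul_def, Real.coe_toNNReal _ (pow_nonneg hr.out.le _)]

variable [Nontrivial E]

theorem integral_polar {F : Type*} [NormedAddCommGroup F] [NormedSpace ℝ F] {f : E → F}
    (hf : Integrable f) :
    ∫ x, f x = ∫ r in Ioi (0 : ℝ), r ^ (finrank ℝ E - 1) •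
      ∫ ν : sphere (0 : E) 1, f (r • ν.1) ∂(volume : Measure E).toSphere := by
  have hpres := (volume : Measure E).measurePreserving_homeomorphUnitSphereProd.symm
    (homeomorphUnitSphereProd E).toMeasurableEquiv
  have hemb := (homeomorphUnitSphereProd E).symm.measurableEmbedding
  have hint : Integrable (fun x : ({0}ᶜ : Set E) => f x.1) (volume.comap Subtype.val) :=
    (integrableOn_iff_comap_subtypeVal (measurableSet_singleton (0 : E)).compl).1 hf.integrableOn
  rw [← integral_volumeIoiPow (finrank ℝ E - 1), ← integral_prod_symm
    (fun p : sphere (0 : E) 1 × Ioi (0 : ℝ) => f (p.2.1 • p.1.1))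
    ((hpres.integrable_comp_emb hemb).2 hint)]
  refine Eq.trans ?_ (hpres.integral_comp hemb (g := fun x => f x.1)).symm
  rw [integral_subtype_comap (measurableSet_singleton _).compl f, restrict_compl_singleton]

theorem integrable_radial_mul_dirCos {e : E} (he : ‖e‖ ≤ 1) {f F : ℝ → ℂ} (hf : Continuous f)
    (hfc : HasCompactSupport f) (hF : Continuous F) :
    Integrable fun η : E => f ‖η‖ * F (dirCos e η) := by
  obtain ⟨M, hM⟩ := (isCompact_Icc (a := (-1 : ℝ)) (b := 1)).exists_bound_of_continuousOn
    hF.continuousOn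
  have hradial : Integrable fun η : E => f ‖η‖ :=
    (integrable_fun_norm_addHaar volume).2
      (Continuous.integrable_of_hasCompactSupport (by fun_prop) hfc.smul_left).integrableOn
  exact hradial.mul_bdd (c := M) (hF.measurable.comp (measurable_dirCos e)).aestronglyMeasurable
    (.of_forall fun η => hM _ (abs_le.1 (abs_dirCos_le_one he η)))

theorem integral_radial_mul_dirCos {e : E} (he : ‖e‖ ≤ 1) {f F : ℝ → ℂ} (hf : Continuous f)
    (hfc : HasCompactSupport f) (hF : Continuous F) :
    ∫ η : E, f ‖η‖ * F (dirCos e η) =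
      (∫ ν : sphere (0 : E) 1, F (inner ℝ ν.1 e) ∂(volume : Measure E).toSphere) *
        ∫ r in Ioi (0 : ℝ), r ^ (finrank ℝ E - 1) • f r := by
  rw [integral_polar (integrable_radial_mul_dirCos he hf hfc hF), ← integral_const_mul]
  refine setIntegral_congr_fun measurableSet_Ioi fun r hr => ?_
  have hnorm (ν : sphere (0 : E) 1) : ‖r • ν.1‖ = r := by
    rw [norm_smul, norm_eq_of_mem_sphere, mul_one, Real.norm_of_nonneg hr.out.le]
  simp only [hnorm, dirCos_smul_sphere e hr, integral_const_mul, Complex.real_smul]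
  ring

end Polar

section Sphere

open Metric Set Module

theorem exists_radialBump : ∃ χ : ℝ → ℝ, ContDiff ℝ 1 χ ∧ HasCompactSupport χ ∧
    tsupport χ ⊆ Ioi 0 ∧ (∀ r, 0 ≤ χ r) ∧ χ 1 = 1 := by
  obtain ⟨χ, hsupp, hcompact, hsmooth, hrange, h1⟩ :=
    exists_contDiff_tsupport_subset (n := 1) (Ioi_mem_nhds (zero_lt_one' ℝ))
  exact ⟨χ, hsmooth, hcompact, hsupp, fun r => (hrange (mem_range_self r)).1, h1⟩

theorem setIntegral_Ioi_pow_mul_deriv {χ : ℝ → ℝ} (hχ : ContDiff ℝ 1 χ)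
    (hc : HasCompactSupport χ) (hs : tsupport χ ⊆ Ioi 0) (k : ℕ) :
    ∫ r in Ioi (0 : ℝ), r ^ k * (χ r + r * deriv χ r) =
      -(k * ∫ r in Ioi (0 : ℝ), r ^ k * χ r) := by
  have hcont : Continuous χ := hχ.continuous
  have hzero (r : ℝ) (hr : r ∉ Ioi 0) : χ r = 0 ∧ deriv χ r = 0 :=
    ⟨image_eq_zero_of_notMem_tsupport fun h => hr (hs h),
      image_eq_zero_of_notMem_tsupport fun h => hr (hs (tsupport_deriv_subset h))⟩
  rw [setIntegral_eq_integral_of_forall_compl_eq_zero fun r hr => by simp [hzero r hr],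
    setIntegral_eq_integral_of_forall_compl_eq_zero fun r hr => by simp [hzero r hr]]
  have hint₀ : Integrable fun r => r ^ k * χ r :=
    Continuous.integrable_of_hasCompactSupport (by fun_prop) hc.mul_left
  have hint₁ : Integrable fun r => r ^ (k + 1) * deriv χ r :=
    Continuous.integrable_of_hasCompactSupport (by fun_prop) hc.deriv.mul_left
  have hparts : ∫ r, r ^ (k + 1) * deriv χ r = -((k + 1) * ∫ r, r ^ k * χ r) := by
    rw [integral_mul_deriv_eq_deriv_mul_of_integrable (u' := fun r => (k + 1) * r ^ k)
      (fun r _ => by simpa using hasDerivAt_pow (k + 1) r)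
      (fun r _ => (hχ.differentiable one_ne_zero r).hasDerivAt) hint₁
      (Continuous.integrable_of_hasCompactSupport (by fun_prop) hc.mul_left)
      (Continuous.integrable_of_hasCompactSupport (by fun_prop) hc.mul_left), ← integral_const_mul]
    simp only [mul_assoc]
  calc ∫ r, r ^ k * (χ r + r * deriv χ r)
      = ∫ r, (r ^ k * χ r + r ^ (k + 1) * deriv χ r) := by congr 1 with r; ring
    _ = -(k * ∫ r, r ^ k * χ r) := by rw [integral_add hint₀ hint₁, hparts]; ring

theorem setIntegral_Ioi_pow_mul_pos {χ : ℝ → ℝ} (hχ : Continuous χ) (hc : HasCompactSupport χ)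
    (h0 : ∀ r, 0 ≤ χ r) {r₀ : ℝ} (hr₀ : 0 < r₀) (hχr₀ : χ r₀ ≠ 0) (k : ℕ) :
    0 < ∫ r in Ioi (0 : ℝ), r ^ k * χ r := by
  have hcont : Continuous fun r => r ^ k * χ r := by fun_prop
  have hpos : 0 < r₀ ^ k * χ r₀ := mul_pos (pow_pos hr₀ k) ((h0 r₀).lt_of_ne' hχr₀)
  rw [setIntegral_pos_iff_support_of_nonneg_ae
    ((ae_restrict_iff' measurableSet_Ioi).2 (.of_forall fun r (hr : 0 < r) =>
      mul_nonneg (pow_nonneg hr.le k) (h0 r)))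
    (hcont.integrable_of_hasCompactSupport hc.mul_left).integrableOn]
  exact (hcont.isOpen_support.inter isOpen_Ioi).measure_pos volume ⟨r₀, hpos.ne', hr₀⟩

variable {E : Type*} [NormedAddCommGroup E] [InnerProductSpace ℝ E]

theorem norm_pow_mul_exp_inner_le {e : E} (he : ‖e‖ ≤ 1) (k : ℕ) (r : ℝ) (ν : sphere (0 : E) 1) :
    ‖((inner ℝ ν.1 e : ℝ) : ℂ) ^ k * Complex.exp (Complex.I * (r * inner ℝ ν.1 e : ℝ))‖ ≤ 1 := by
  rw [norm_mul, mul_comm Complex.I, Complex.norm_exp_ofReal_mul_I, mul_one, norm_pow,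
    Complex.norm_real]
  exact pow_le_one₀ (norm_nonneg _) (abs_inner_sphere_le he ν)

theorem hasLineDerivAt_cutoff_mul_dirCos {χ : ℝ → ℝ} (hχ : Differentiable ℝ χ)
    (hs : tsupport χ ⊆ Ioi 0) {e : E} (he : ‖e‖ = 1) {g g' : ℝ → ℂ}
    (hg : ∀ u, HasDerivAt g (g' u) u) (η : E) :
    HasLineDerivAt ℝ (fun ξ => ((‖ξ‖ * χ ‖ξ‖ : ℝ) : ℂ) * g (dirCos e ξ))
      (((χ ‖η‖ + ‖η‖ * deriv χ ‖η‖ : ℝ) : ℂ) * (dirCos e η * g (dirCos e η)) +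
        (χ ‖η‖ : ℂ) * (g' (dirCos e η) * (1 - (dirCos e η : ℂ) ^ 2))) η e := by
  rcases eq_or_ne η 0 with rfl | hη
  · have hnear : χ =ᶠ[nhds 0] 0 :=
      notMem_tsupport_iff_eventuallyEq.1 fun h => lt_irrefl _ (mem_Ioi.1 (hs h))
    have hline : Filter.Tendsto (fun s : ℝ => ‖(0 : E) + s • e‖) (nhds 0) (nhds 0) := by
      simpa using (by fun_prop : Continuous fun s : ℝ => ‖(0 : E) + s • e‖).tendsto 0
    refine ((hasDerivAt_const (0 : ℝ) (0 : ℂ)).congr_of_eventuallyEq ?_).congr_deriv ?_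
    · filter_upwards [hline.eventually hnear] with s hχs
      rw [hχs, Pi.zero_apply, mul_zero, Complex.ofReal_zero, zero_mul]
    · simp [hnear.eq_of_nhds]
  · have hψ : HasDerivAt (fun r : ℝ => ((r * χ r : ℝ) : ℂ))
        ((χ ‖η‖ + ‖η‖ * deriv χ ‖η‖ : ℝ) : ℂ) ‖η‖ := by
      have hmul := (hasDerivAt_id ‖η‖).mul (hχ ‖η‖).hasDerivAt
      rw [one_mul] at hmul
      exact hmul.ofReal_comp
    have hη' : (‖η‖ : ℂ) ≠ 0 := by simpa using hη
    convert hasLineDerivAt_radial_mul_dirCos he hη hψ (hg (dirCos e η)) using 3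
    rw [Complex.ofReal_mul, mul_div_cancel_left₀ _ hη']

variable [FiniteDimensional ℝ E] [MeasurableSpace E] [BorelSpace E]

theorem integral_eq_zero_of_hasLineDerivAt {F : Type*} [NormedAddCommGroup F] [NormedSpace ℝ F]
    {Φ Φ' : E → F} {e : E} (hΦ : Integrable Φ) (hΦ' : Integrable Φ')
    (hderiv : ∀ η, HasLineDerivAt ℝ Φ (Φ' η) η e) : ∫ η, Φ' η = 0 := by
  have h := integral_bilinear_hasLineDerivAt_right_eq_neg_left_of_integrable (μ := volume)
    (f := fun _ : E => (1 : ℝ)) (f' := fun _ => 0) (v := e) (B := ContinuousLinearMap.lsmul ℝ ℝ)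
    (by simp) (by simpa using hΦ') (by simpa using hΦ)
    (fun η _ => hasDerivAt_const (0 : ℝ) (1 : ℝ)) (fun η _ => hderiv η)
  simpa using h

/-- The divergence theorem on the unit sphere for the gradient of `⟨·, e⟩` times `g ⟨·, e⟩`. It is
obtained by integrating the derivative of `η ↦ ‖η‖ χ(‖η‖) g(cos ∠(η, e))` in the direction `e`. -/
theorem integral_sphere_by_parts [Nontrivial E] {e : E} (he : ‖e‖ = 1) {g g' : ℝ → ℂ}
    (hg : ∀ u, HasDerivAt g (g' u) u) (hg' : Continuous g') :
    ∫ ν : sphere (0 : E) 1, g' (inner ℝ ν.1 e) * (1 - (inner ℝ ν.1 e : ℝ) ^ 2)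
        ∂(volume : Measure E).toSphere =
      ((finrank ℝ E - 1 : ℕ) : ℂ) * ∫ ν : sphere (0 : E) 1,
        (inner ℝ ν.1 e : ℝ) * g (inner ℝ ν.1 e) ∂(volume : Measure E).toSphere := by
  obtain ⟨χ, hχ, hc, hs, hχ0, hχ1⟩ := exists_radialBump
  have hg_cont : Continuous g := continuous_iff_continuousAt.2 fun u => (hg u).continuousAt
  have hχ_cont : Continuous χ := hχ.continuous
  let f₀ : ℝ → ℂ := fun r => ((r * χ r : ℝ) : ℂ)
  let f₁ : ℝ → ℂ := fun r => ((χ r + r * deriv χ r : ℝ) : ℂ)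
  let f₂ : ℝ → ℂ := fun r => (χ r : ℂ)
  let F₁ : ℝ → ℂ := fun u => u * g u
  let F₂ : ℝ → ℂ := fun u => g' u * (1 - (u : ℂ) ^ 2)
  have hf₁ : Continuous f₁ := by fun_prop
  have hf₂ : Continuous f₂ := by fun_prop
  have hf₁c : HasCompactSupport f₁ := (hc.add hc.deriv.mul_left).comp_left (g := Complex.ofReal) rfl
  have hf₂c : HasCompactSupport f₂ := hc.comp_left (g := Complex.ofReal) rfl
  have hF₁ : Continuous F₁ := by fun_prop
  have hF₂ : Continuous F₂ := by fun_prop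
  have hint₁ := integrable_radial_mul_dirCos he.le hf₁ hf₁c hF₁
  have hint₂ := integrable_radial_mul_dirCos he.le hf₂ hf₂c hF₂
  have hzero : ∫ η : E, (f₁ ‖η‖ * F₁ (dirCos e η) + f₂ ‖η‖ * F₂ (dirCos e η)) = 0 :=
    integral_eq_zero_of_hasLineDerivAt
      (integrable_radial_mul_dirCos he.le (f := f₀) (by fun_prop)
        (hc.mul_left.comp_left (g := Complex.ofReal) rfl) hg_cont)
      (hint₁.add hint₂)
      (hasLineDerivAt_cutoff_mul_dirCos (hχ.differentiable one_ne_zero) hs he hg)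
  rw [integral_add hint₁ hint₂, integral_radial_mul_dirCos he.le hf₁ hf₁c hF₁,
    integral_radial_mul_dirCos he.le hf₂ hf₂c hF₂] at hzero
  have hradial (f : ℝ → ℝ) : ∫ r in Ioi (0 : ℝ), r ^ (finrank ℝ E - 1) • (f r : ℂ) =
      ((∫ r in Ioi (0 : ℝ), r ^ (finrank ℝ E - 1) * f r : ℝ) : ℂ) := by
    rw [← integral_complex_ofReal]
    simp only [Complex.real_smul, Complex.ofReal_mul]
  rw [hradial, hradial, setIntegral_Ioi_pow_mul_deriv hχ hc hs] at hzero
  have hpos := setIntegral_Ioi_pow_mul_pos hχ_cont hc hχ0 one_pos (by simp [hχ1])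
    (finrank ℝ E - 1)
  refine mul_right_cancel₀ (Complex.ofReal_ne_zero.2 hpos.ne') ?_
  push_cast at hzero ⊢
  linear_combination hzero

/-- `∫ ⟨ν, e⟩ᵏ e^{ir⟨ν, e⟩} dσ(ν)` over the unit sphere: for `k = 0`, the Fourier transform of the
surface measure at `r e`. -/
def sphereMoment (e : E) (k : ℕ) (r : ℝ) : ℂ :=
  ∫ ν : sphere (0 : E) 1, ((inner ℝ ν.1 e : ℝ) : ℂ) ^ k *
    Complex.exp (Complex.I * (r * inner ℝ ν.1 e : ℝ)) ∂(volume : Measure E).toSphere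

theorem norm_sphereMoment_le {e : E} (he : ‖e‖ ≤ 1) (k : ℕ) (r : ℝ) :
    ‖sphereMoment e k r‖ ≤ (volume : Measure E).toSphere.real univ := by
  have h := norm_integral_le_of_norm_le_const (μ := (volume : Measure E).toSphere)
    (.of_forall (norm_pow_mul_exp_inner_le he k r))
  rwa [one_mul] at h

theorem integrable_sphereMoment (e : E) (k : ℕ) (r : ℝ) :
    Integrable (fun ν : sphere (0 : E) 1 => ((inner ℝ ν.1 e : ℝ) : ℂ) ^ k *
      Complex.exp (Complex.I * (r * inner ℝ ν.1 e : ℝ))) (volume : Measure E).toSphere :=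
  integrable_sphere (f := fun u => (u : ℂ) ^ k * Complex.exp (Complex.I * (r * u : ℝ)))
    (by fun_prop) e

theorem hasDerivAt_cexp_I_mul (a u : ℝ) :
    HasDerivAt (fun u : ℝ => Complex.exp (Complex.I * (a * u : ℝ)))
      (Complex.I * a * Complex.exp (Complex.I * (a * u : ℝ))) u := by
  have hlin : HasDerivAt (fun u : ℝ => Complex.I * ((a * u : ℝ) : ℂ)) (Complex.I * a) u := by
    simpa using (((hasDerivAt_id u).const_mul a).ofReal_comp).const_mul Complex.I
  exact hlin.cexp.congr_deriv (mul_comm _ _)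

theorem hasDerivAt_sphereMoment {e : E} (he : ‖e‖ ≤ 1) (k : ℕ) (r : ℝ) :
    HasDerivAt (sphereMoment e k) (Complex.I * sphereMoment e (k + 1) r) r := by
  rw [sphereMoment, ← integral_const_mul]
  refine (hasDerivAt_integral_of_dominated_loc_of_deriv_le (s := univ) (bound := fun _ => 1)
    (F := fun (r : ℝ) (ν : sphere (0 : E) 1) => ((inner ℝ ν.1 e : ℝ) : ℂ) ^ k *
      Complex.exp (Complex.I * (r * inner ℝ ν.1 e : ℝ)))
    (F' := fun (r : ℝ) (ν : sphere (0 : E) 1) => Complex.I * (((inner ℝ ν.1 e : ℝ) : ℂ) ^ (k + 1) *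
      Complex.exp (Complex.I * (r * inner ℝ ν.1 e : ℝ)))) Filter.univ_mem
    (.of_forall fun r => (integrable_sphereMoment e k r).aestronglyMeasurable)
    (integrable_sphereMoment e k r)
    ((integrable_sphereMoment e (k + 1) r).const_mul _).aestronglyMeasurable
    (.of_forall fun ν r _ => ?_) (integrable_const _) (.of_forall fun ν r _ => ?_)).2
  · rw [norm_mul, Complex.norm_I, one_mul]
    exact norm_pow_mul_exp_inner_le he (k + 1) r ν
  · have hexp := (hasDerivAt_cexp_I_mul (inner ℝ ν.1 e) r).const_mul
      (((inner ℝ ν.1 e : ℝ) : ℂ) ^ k)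
    simp only [mul_comm _ (inner ℝ ν.1 e : ℝ), pow_succ] at hexp ⊢
    exact hexp.congr_deriv (by ring)

theorem sphereMoment_bessel [Nontrivial E] {e : E} (he : ‖e‖ = 1) (r : ℝ) :
    Complex.I * r * (sphereMoment e 0 r - sphereMoment e 2 r) =
      ((finrank ℝ E - 1 : ℕ) : ℂ) * sphereMoment e 1 r := by
  have h := integral_sphere_by_parts he (hasDerivAt_cexp_I_mul r) (by fun_prop)
  simp only [sphereMoment, pow_one]
  rw [← h, ← integral_sub (integrable_sphereMoment e 0 r) (integrable_sphereMoment e 2 r),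
    ← integral_const_mul]
  congr 1 with ν
  ring

end Sphere

section Bessel

open Set Module

theorem abs_two_mul_inner_le {V : Type*} [NormedAddCommGroup V] [InnerProductSpace ℝ V] (w v : V) :
    |2 * inner ℝ w v| ≤ ‖w‖ ^ 2 + ‖v‖ ^ 2 := by
  rw [abs_mul, abs_two]
  nlinarith [abs_real_inner_le_norm w v, sq_nonneg (‖w‖ - ‖v‖)]

/-- The energy `‖w‖² + ‖w'‖²` changes at the relative rate at most `|b| / r²`, so that
`(‖w‖² + ‖w'‖²) e^{|b|/r}` is nonincreasing. -/
theorem norm_sq_le_of_hasDerivAt_bessel {V : Type*} [NormedAddCommGroup V] [InnerProductSpace ℝ V]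
    {w v : ℝ → V} {b : ℝ} (hw : ∀ r, 0 < r → HasDerivAt w (v r) r)
    (hv : ∀ r, 0 < r → HasDerivAt v ((b / r ^ 2 - 1) • w r) r) {r : ℝ} (hr : 1 ≤ r) :
    ‖w r‖ ^ 2 ≤ (‖w 1‖ ^ 2 + ‖v 1‖ ^ 2) * Real.exp |b| := by
  let N : ℝ → ℝ := fun r => (‖w r‖ ^ 2 + ‖v r‖ ^ 2) * Real.exp (|b| * r⁻¹)
  have hderiv (r : ℝ) (hr : 0 < r) : HasDerivAt N
      (-(Real.exp (|b| * r⁻¹) / r ^ 2 *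
        (|b| * (‖w r‖ ^ 2 + ‖v r‖ ^ 2) - b * (2 * inner ℝ (w r) (v r))))) r := by
    refine (((hw r hr).norm_sq.add (hv r hr).norm_sq).mul
      (((hasDerivAt_inv hr.ne').const_mul |b|).exp)).congr_deriv ?_
    rw [Pi.add_apply, real_inner_smul_right, real_inner_comm (w r) (v r)]
    field_simp
    ring
  have hdissip (r : ℝ) :
      b * (2 * inner ℝ (w r) (v r)) ≤ |b| * (‖w r‖ ^ 2 + ‖v r‖ ^ 2) := by
    refine (le_abs_self _).trans ?_
    rw [abs_mul]
    exact mul_le_mul_of_nonneg_left (abs_two_mul_inner_le _ _) (abs_nonneg b)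
  have hanti : AntitoneOn N (Ici 1) := by
    refine antitoneOn_of_hasDerivWithinAt_nonpos (convex_Ici 1)
      (fun r hr => (hderiv r (one_pos.trans_le hr)).continuousAt.continuousWithinAt)
      (fun r hr => (hderiv r (one_pos.trans_le (interior_subset hr))).hasDerivWithinAt)
      fun r _ => neg_nonpos.2 (mul_nonneg (by positivity) (sub_nonneg.2 (hdissip r)))
  have hexp : 1 ≤ Real.exp (|b| * r⁻¹) := Real.one_le_exp (by positivity)
  calc ‖w r‖ ^ 2 ≤ (‖w r‖ ^ 2 + ‖v r‖ ^ 2) * Real.exp (|b| * r⁻¹) := by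
        nlinarith [sq_nonneg ‖w r‖, sq_nonneg ‖v r‖]
    _ ≤ (‖w 1‖ ^ 2 + ‖v 1‖ ^ 2) * Real.exp (|b| * 1⁻¹) := hanti self_mem_Ici hr hr
    _ = _ := by rw [inv_one, mul_one]

variable {E : Type*} [NormedAddCommGroup E] [InnerProductSpace ℝ E] [FiniteDimensional ℝ E]
  [MeasurableSpace E] [BorelSpace E]

theorem hasDerivAt_rpow_smul {V : Type*} [NormedAddCommGroup V] [NormedSpace ℝ V] {f : ℝ → V}
    {f' : V} {r : ℝ} (hf : HasDerivAt f f' r) (hr : 0 < r) (a : ℝ) :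
    HasDerivAt (fun r : ℝ => r ^ a • f r) (r ^ a • ((a / r) • f r + f')) r := by
  refine ((Real.hasDerivAt_rpow_const (p := a) (Or.inl hr.ne')).smul hf).congr_deriv ?_
  rw [Real.rpow_sub_one hr.ne', smul_add, smul_smul, mul_div_left_comm, add_comm]

/-- The derivative of `r ↦ r ^ a • sphereMoment e 0 r`. -/
def besselDeriv (a : ℝ) (e : E) (r : ℝ) : ℂ :=
  r ^ a • ((a / r) • sphereMoment e 0 r + Complex.I * sphereMoment e 1 r)

theorem hasDerivAt_rpow_smul_sphereMoment {e : E} (he : ‖e‖ ≤ 1) (a : ℝ) {r : ℝ} (hr : 0 < r) :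
    HasDerivAt (fun r => r ^ a • sphereMoment e 0 r) (besselDeriv a e r) r :=
  hasDerivAt_rpow_smul (hasDerivAt_sphereMoment he 0 r) hr a

theorem hasDerivAt_besselDeriv [Nontrivial E] {e : E} (he : ‖e‖ = 1) {a : ℝ}
    (ha : finrank ℝ E = 2 * a + 1) {r : ℝ} (hr : 0 < r) :
    HasDerivAt (besselDeriv a e)
      ((a * (a - 1) / r ^ 2 - 1) • (r ^ a • sphereMoment e 0 r)) r := by
  have hinv : HasDerivAt (fun r : ℝ => a / r) (-a / r ^ 2) r := by
    simpa [div_eq_mul_inv] using (hasDerivAt_inv hr.ne').const_mul a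
  have hinner := (hinv.smul (hasDerivAt_sphereMoment he.le 0 r)).add
    ((hasDerivAt_sphereMoment he.le 1 r).const_mul Complex.I)
  refine (hasDerivAt_rpow_smul hinner hr a).congr_deriv ?_
  have hbessel := sphereMoment_bessel he r
  have hdim : ((finrank ℝ E - 1 : ℕ) : ℂ) = 2 * a := by
    rw [Nat.cast_pred finrank_pos, ← Complex.ofReal_natCast, ha]
    push_cast
    ring
  have hr' : (r : ℂ) ≠ 0 := Complex.ofReal_ne_zero.2 hr.ne'
  rw [hdim] at hbessel
  simp only [Complex.real_smul, Pi.add_apply, Pi.smul_apply']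
  push_cast
  field_simp
  linear_combination ((r ^ a : ℝ) : ℂ) * (r ^ 2 * sphereMoment e 0 r * Complex.I_sq -
    r * Complex.I * hbessel)

theorem exists_norm_sphereMoment_le [Nontrivial E] :
    ∃ C : ℝ, 0 ≤ C ∧ ∀ (e : E) (r : ℝ), ‖e‖ = 1 → 0 < r →
      ‖sphereMoment e 0 r‖ ≤ C * r ^ (-(((finrank ℝ E : ℝ) - 1) / 2)) := by
  let a : ℝ := ((finrank ℝ E : ℝ) - 1) / 2
  let S : ℝ := (volume : Measure E).toSphere.real univ
  let K : ℝ := (S ^ 2 + (a * S + S) ^ 2) * Real.exp |a * (a - 1)|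
  have ha : 0 ≤ a := div_nonneg (sub_nonneg.2 (Nat.one_le_cast.2 finrank_pos)) two_pos.le
  have hmoment (e : E) (he : ‖e‖ = 1) (k : ℕ) (r : ℝ) : ‖sphereMoment e k r‖ ≤ S :=
    norm_sphereMoment_le he.le k r
  refine ⟨max √K S, by positivity, fun e r he hr => ?_⟩
  rcases le_total r 1 with hr1 | hr1
  · calc ‖sphereMoment e 0 r‖ ≤ max √K S * 1 := by
          rw [mul_one]; exact (hmoment e he 0 r).trans (le_max_right _ _)
      _ ≤ max √K S * r ^ (-a) := by
          gcongr
          exact Real.one_le_rpow_of_pos_of_le_one_of_nonpos hr hr1 (neg_nonpos.2 ha)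
  have hinit : ‖(1 : ℝ) ^ a • sphereMoment e 0 1‖ ^ 2 + ‖besselDeriv a e 1‖ ^ 2 ≤
      S ^ 2 + (a * S + S) ^ 2 := by
    rw [besselDeriv, Real.one_rpow, one_smul, one_smul, div_one]
    gcongr
    · exact hmoment e he 0 1
    · refine norm_add_le_of_le ?_ ?_
      · rw [norm_smul, Real.norm_of_nonneg ha]
        exact mul_le_mul_of_nonneg_left (hmoment e he 0 1) ha
      · rw [norm_mul, Complex.norm_I, one_mul]
        exact hmoment e he 1 1
  have hbound : ‖r ^ a • sphereMoment e 0 r‖ ≤ √K :=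
    Real.le_sqrt_of_sq_le <| (norm_sq_le_of_hasDerivAt_bessel
      (fun r hr => hasDerivAt_rpow_smul_sphereMoment he.le a hr)
      (fun r hr => hasDerivAt_besselDeriv he (by simp only [a]; ring) hr) hr1).trans
      (mul_le_mul_of_nonneg_right hinit (Real.exp_nonneg _))
  rw [norm_smul, Real.norm_of_nonneg (by positivity)] at hbound
  rw [Real.rpow_neg hr.le, ← div_eq_mul_inv, le_div_iff₀ (by positivity), mul_comm]
  exact hbound.trans (le_max_left _ _)

end Bessel

section Kernel

open Metric Set Module

variable {E : Type*} [NormedAddCommGroup E]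

/-- The symbol `e^{it2π|ξ|} φ(h2π|ξ|)` of the operator `e^{it√G₀} φ(h√G₀)`. -/
def symbol (φ : ℝ → ℂ) (t h : ℝ) (ξ : E) : ℂ :=
  waveFun φ t h ((2 * Real.pi * ‖ξ‖) ^ 2)

variable {φ : ℝ → ℂ}

theorem symbol_eq (t h : ℝ) (ξ : E) :
    symbol φ t h ξ = Complex.exp (Complex.I * (t * (2 * Real.pi * ‖ξ‖) : ℝ)) *
      φ (h * (2 * Real.pi * ‖ξ‖)) := by
  rw [symbol, waveFun, Real.sqrt_sq (by positivity)]

theorem continuous_symbol (hφ : Continuous φ) (t h : ℝ) :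
    Continuous (symbol φ t h : E → ℂ) := by
  simp only [funext (symbol_eq t h)]
  fun_prop

theorem norm_symbol (t h : ℝ) (ξ : E) : ‖symbol φ t h ξ‖ = ‖φ (h * (2 * Real.pi * ‖ξ‖))‖ := by
  rw [symbol_eq, norm_mul, mul_comm Complex.I, Complex.norm_exp_ofReal_mul_I, one_mul]

/-- The function `r^k φ(2πr)`; for `k = d - 1` it is the radial amplitude of the kernel at `h = 1`
on a `d`-dimensional space. -/
def amplitude (k : ℕ) (φ : ℝ → ℂ) (r : ℝ) : ℂ :=
  r ^ k • φ (2 * Real.pi * r)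

theorem contDiff_amplitude {m : ℕ∞ω} (hφ : ContDiff ℝ m φ) (k : ℕ) :
    ContDiff ℝ m (amplitude k φ) :=
  (contDiff_id.pow k).smul (hφ.comp (contDiff_const.mul contDiff_id))

theorem hasCompactSupport_comp_two_pi_mul (hc : HasCompactSupport φ) :
    HasCompactSupport fun r => φ (2 * Real.pi * r) :=
  hc.comp_homeomorph (Homeomorph.mulLeft₀ (2 * Real.pi) (by positivity))

theorem continuous_amplitude (hφ : Continuous φ) (k : ℕ) : Continuous (amplitude k φ) :=
  (continuous_pow k).smul (hφ.comp (continuous_const_mul _))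

theorem hasCompactSupport_amplitude (hc : HasCompactSupport φ) (k : ℕ) :
    HasCompactSupport (amplitude k φ) :=
  (hasCompactSupport_comp_two_pi_mul hc).smul_left (f := fun r : ℝ => r ^ k)

theorem amplitude_eq_zero (hsupp : tsupport φ ⊆ Ioi 0) (k : ℕ) {r : ℝ} (hr : r ≤ 0) :
    amplitude k φ r = 0 := by
  have hφr : φ (2 * Real.pi * r) = 0 := image_eq_zero_of_notMem_tsupport fun h =>
    (hsupp h).not_ge (mul_nonpos_of_nonneg_of_nonpos (by positivity) hr)
  rw [amplitude, hφr, smul_zero]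

variable [InnerProductSpace ℝ E]

theorem symbol_eq_symbol_smul {h : ℝ} (hh : 0 < h) (t : ℝ) (ξ : E) :
    symbol φ t h ξ = symbol φ (t / h) 1 (h • ξ) := by
  rw [symbol_eq, symbol_eq, norm_smul, Real.norm_of_nonneg hh.le]
  congr 2
  · field_simp
  · ring_nf

variable [FiniteDimensional ℝ E]

theorem hasCompactSupport_symbol (hc : HasCompactSupport φ) {h : ℝ} (hh : 0 < h) (t : ℝ) :
    HasCompactSupport (symbol φ t h : E → ℂ) := by
  obtain ⟨b, hb⟩ := hc.isCompact.isBounded.subset_closedBall (0 : ℝ)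
  refine .of_support_subset_isCompact
    (isCompact_closedBall (0 : E) (b / (h * (2 * Real.pi)))) fun ξ hξ => ?_
  have hmem : h * (2 * Real.pi * ‖ξ‖) ∈ closedBall (0 : ℝ) b :=
    hb (subset_tsupport φ fun h0 => hξ (by rw [symbol_eq, h0, mul_zero]))
  rw [mem_closedBall_zero_iff, Real.norm_of_nonneg (by positivity)] at hmem
  rw [mem_closedBall_zero_iff, le_div_iff₀ (by positivity)]
  linarith

variable [MeasurableSpace E] [BorelSpace E]

theorem memLp_symbol_of_pos (hφ : Continuous φ) (hc : HasCompactSupport φ) {h : ℝ} (hh : 0 < h)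
    (t : ℝ) (p : ℝ≥0∞) : MemLp (symbol φ t h : E → ℂ) p :=
  (continuous_symbol hφ t h).memLp_of_hasCompactSupport (hasCompactSupport_symbol hc hh t)

theorem integrable_symbol (hφ : Continuous φ) (hc : HasCompactSupport φ) {h : ℝ} (hh : 0 < h)
    (t : ℝ) : Integrable (symbol φ t h : E → ℂ) :=
  memLp_one_iff_integrable.1 (memLp_symbol_of_pos hφ hc hh t 1)

/-- The convolution kernel of `e^{it√G₀} φ(h√G₀)`. -/
def kernel (φ : ℝ → ℂ) (t h : ℝ) : E → ℂ := 𝓕⁻ (symbol φ t h : E → ℂ)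

theorem continuous_kernel (hφ : Continuous φ) (hc : HasCompactSupport φ) {h : ℝ} (hh : 0 < h) :
    Continuous fun p : ℝ × E => kernel φ p.1 h p.2 := by
  have htime (ξ : E) : Continuous fun p : ℝ × E => symbol φ p.1 h ξ := by
    simp only [symbol_eq]
    fun_prop
  simp only [kernel, Real.fourierInv_eq]
  refine continuous_of_dominated (bound := fun ξ => ‖symbol φ 0 h ξ‖) (fun p => ?_)
    (fun p => .of_forall fun ξ => ?_) (integrable_symbol hφ hc hh 0).norm
    (.of_forall fun ξ => Continuous.smul (by fun_prop) (htime ξ))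
  · exact (Continuous.smul (by fun_prop) (continuous_symbol hφ p.1 h)).aestronglyMeasurable
  · rw [Circle.norm_smul, norm_symbol, norm_symbol]

theorem kernel_eq_kernel_smul {h : ℝ} (hh : 0 < h) (t : ℝ) (x : E) :
    kernel φ t h x = (h ^ finrank ℝ E)⁻¹ • kernel φ (t / h) 1 (h⁻¹ • x) := by
  have hscale := Measure.integral_comp_smul_of_nonneg volume (fun ξ : E =>
    Complex.exp ((2 * Real.pi * inner ℝ ξ (h⁻¹ • x) : ℝ) * Complex.I) • symbol φ (t / h) 1 ξ) h
    (hR := hh.le)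
  rw [kernel, kernel, Real.fourierInv_eq', Real.fourierInv_eq', ← hscale]
  congr 1 with ξ
  rw [symbol_eq_symbol_smul hh, real_inner_smul_left, real_inner_smul_right,
    mul_inv_cancel_left₀ hh.ne']

theorem norm_kernel_eq {h : ℝ} (hh : 0 < h) (t : ℝ) (x : E) :
    ‖kernel φ t h x‖ = (h ^ finrank ℝ E)⁻¹ * ‖kernel φ (t / h) 1 (h⁻¹ • x)‖ := by
  rw [kernel_eq_kernel_smul hh, norm_smul, Real.norm_of_nonneg (by positivity)]

/-- The kernel at `h = 1` and `x = ρ e` is, as a function of time, the inverse Fourier transform of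
this function. -/
def profile (φ : ℝ → ℂ) (e : E) (ρ r : ℝ) : ℂ :=
  amplitude (finrank ℝ E - 1) φ r * sphereMoment e 0 (2 * Real.pi * r * ρ)

theorem continuous_profile (hφ : Continuous φ) {e : E} (he : ‖e‖ = 1) (ρ : ℝ) :
    Continuous (profile φ e ρ) := by
  have hmoment : Continuous (sphereMoment e 0) :=
    continuous_iff_continuousAt.2 fun r => (hasDerivAt_sphereMoment he.le 0 r).continuousAt
  exact (continuous_amplitude hφ _).mul
    (hmoment.comp (by fun_prop))

theorem memLp_profile (hφ : Continuous φ) (hc : HasCompactSupport φ) {e : E} (he : ‖e‖ = 1)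
    (ρ : ℝ) (p : ℝ≥0∞) : MemLp (profile φ e ρ) p :=
  (continuous_profile hφ he ρ).memLp_of_hasCompactSupport
    (hasCompactSupport_amplitude hc _).mul_right

variable [Nontrivial E]

theorem kernel_eq_integral_polar (hφ : Continuous φ) (hc : HasCompactSupport φ)
    (hsupp : tsupport φ ⊆ Ioi 0) (t : ℝ) (x : E) :
    kernel φ t 1 x = ∫ r : ℝ, ∫ ν : sphere (0 : E) 1,
      Complex.exp (Complex.I * (2 * Real.pi * r * (inner ℝ ν.1 x + t) : ℝ)) *
        amplitude (finrank ℝ E - 1) φ r ∂(volume : Measure E).toSphere := by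
  have hint : Integrable fun ξ : E =>
      Complex.exp ((2 * Real.pi * inner ℝ ξ x : ℝ) * Complex.I) • symbol φ t 1 ξ := by
    have hcont : Continuous fun ξ : E =>
      Complex.exp ((2 * Real.pi * inner ℝ ξ x : ℝ) * Complex.I) := by fun_prop
    exact (integrable_symbol hφ hc one_pos t).bdd_smul 1 hcont.aestronglyMeasurable
      (.of_forall fun ξ => (Complex.norm_exp_ofReal_mul_I _).le)
  have hzero (r : ℝ) (hr : r ∉ Ioi 0) : ∫ ν : sphere (0 : E) 1,
      Complex.exp (Complex.I * (2 * Real.pi * r * (inner ℝ ν.1 x + t) : ℝ)) *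
        amplitude (finrank ℝ E - 1) φ r ∂(volume : Measure E).toSphere = 0 := by
    rw [amplitude_eq_zero hsupp _ (not_lt.1 hr)]
    simp only [mul_zero, integral_zero]
  rw [kernel, Real.fourierInv_eq', integral_polar hint,
    ← setIntegral_eq_integral_of_forall_compl_eq_zero hzero]
  refine setIntegral_congr_fun measurableSet_Ioi fun r (hr : 0 < r) => ?_
  rw [← integral_smul]
  congr 1 with ν
  rw [symbol_eq, norm_smul, norm_eq_of_mem_sphere ν, Real.norm_of_nonneg hr.le,
    real_inner_smul_left, amplitude, smul_eq_mul, ← mul_assoc, ← Complex.exp_add, mul_one, one_mul,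
    ← mul_smul_comm]
  congr 2
  push_cast
  ring

theorem kernel_smul_eq_fourierInv_profile (hφ : Continuous φ) (hc : HasCompactSupport φ)
    (hsupp : tsupport φ ⊆ Ioi 0) (e : E) (ρ t : ℝ) :
    kernel φ t 1 (ρ • e) = 𝓕⁻ (profile φ e ρ) t := by
  rw [kernel_eq_integral_polar hφ hc hsupp, Real.fourierInv_eq']
  congr 1 with r
  simp only [profile, sphereMoment, pow_zero, one_mul, smul_eq_mul]
  rw [← integral_const_mul, ← integral_const_mul]
  congr 1 with ν
  rw [mul_left_comm, ← Complex.exp_add, mul_comm, real_inner_smul_right, Real.inner_apply]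
  congr 2
  push_cast
  ring

theorem kernel_eq_integral_sphere (hφ : Continuous φ) (hc : HasCompactSupport φ)
    (hsupp : tsupport φ ⊆ Ioi 0) (t : ℝ) (x : E) :
    kernel φ t 1 x = ∫ ν : sphere (0 : E) 1, 𝓕⁻ (amplitude (finrank ℝ E - 1) φ) (inner ℝ ν.1 x + t)
      ∂(volume : Measure E).toSphere := by
  have hamp : Integrable (amplitude (finrank ℝ E - 1) φ) :=
    (continuous_amplitude hφ _).integrable_of_hasCompactSupport
      (hasCompactSupport_amplitude hc _)
  have hint : Integrable (fun p : ℝ × sphere (0 : E) 1 =>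
      Complex.exp (Complex.I * (2 * Real.pi * p.1 * (inner ℝ p.2.1 x + t) : ℝ)) *
        amplitude (finrank ℝ E - 1) φ p.1) (volume.prod (volume : Measure E).toSphere) := by
    refine (hamp.comp_fst _).bdd_mul (c := 1)
      (Continuous.aestronglyMeasurable (by fun_prop)) (.of_forall fun p => ?_)
    rw [mul_comm, Complex.norm_exp_ofReal_mul_I]
  rw [kernel_eq_integral_polar hφ hc hsupp, integral_integral_swap hint]
  congr 1 with ν
  rw [Real.fourierInv_eq']
  congr 1 with r
  rw [smul_eq_mul, Real.inner_apply, mul_comm Complex.I, mul_assoc (2 * Real.pi)]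

theorem exists_norm_profile_le (hφ : Continuous φ) (hc : HasCompactSupport φ)
    (hsupp : tsupport φ ⊆ Ioi 0) :
    ∃ g : ℝ → ℝ, Continuous g ∧ HasCompactSupport g ∧ (∀ r, 0 ≤ g r) ∧
      ∀ (e : E) (ρ r : ℝ), ‖e‖ = 1 → 0 < ρ →
        ‖profile φ e ρ r‖ ≤ ρ ^ (-(((finrank ℝ E : ℝ) - 1) / 2)) * g r := by
  let a : ℝ := ((finrank ℝ E : ℝ) - 1) / 2
  have ha : 0 ≤ a := div_nonneg (sub_nonneg.2 (Nat.one_le_cast.2 finrank_pos)) two_pos.le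
  obtain ⟨C, hC0, hC⟩ := exists_norm_sphereMoment_le (E := E)
  refine ⟨fun r => C * (2 * Real.pi) ^ (-a) * (|r| ^ a * ‖φ (2 * Real.pi * r)‖), ?_, ?_,
    fun r => by positivity, fun e ρ r he hρ => ?_⟩
  · have : Continuous fun r : ℝ => |r| ^ a := continuous_abs.rpow_const fun _ => Or.inr ha
    fun_prop
  · exact (hasCompactSupport_comp_two_pi_mul hc).norm.mul_left.mul_left
  rcases le_or_gt r 0 with hr | hr
  · rw [profile, amplitude_eq_zero hsupp _ hr, zero_mul, norm_zero]
    positivity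
  have hpow : r ^ (finrank ℝ E - 1) = r ^ a * r ^ a := by
    rw [← Real.rpow_add hr, ← Real.rpow_natCast, Nat.cast_pred finrank_pos]
    simp only [a, add_halves]
  calc ‖profile φ e ρ r‖
      = r ^ (finrank ℝ E - 1) * ‖φ (2 * Real.pi * r)‖ *
          ‖sphereMoment e 0 (2 * Real.pi * r * ρ)‖ := by
        rw [profile, amplitude, norm_mul, norm_smul, Real.norm_of_nonneg (by positivity)]
    _ ≤ r ^ (finrank ℝ E - 1) * ‖φ (2 * Real.pi * r)‖ * (C * (2 * Real.pi * r * ρ) ^ (-a)) := by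
        gcongr
        exact hC e _ he (by positivity)
    _ = ρ ^ (-a) * (C * (2 * Real.pi) ^ (-a) * (|r| ^ a * ‖φ (2 * Real.pi * r)‖)) := by
        rw [hpow, abs_of_pos hr, Real.mul_rpow (by positivity) hρ.le,
          Real.mul_rpow (by positivity) hr.le, Real.rpow_neg hr.le]
        field_simp

end Kernel

section KernelBounds

open Metric Set Module

theorem eLpNorm_two_sq {α : Type*} [MeasurableSpace α] {μ : Measure α} (f : α → ℂ) :
    eLpNorm f 2 μ ^ 2 = ∫⁻ x, ‖f x‖ₑ ^ 2 ∂μ := by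
  have := eLpNorm_nnreal_pow_eq_lintegral (μ := μ) (f := f) (p := 2) two_ne_zero
  simpa only [NNReal.coe_ofNat, ENNReal.coe_ofNat, ENNReal.rpow_ofNat] using this

theorem enorm_sq_eq_ofReal {F : Type*} [SeminormedAddCommGroup F] (z : F) :
    ‖z‖ₑ ^ 2 = ENNReal.ofReal (‖z‖ ^ 2) := by
  rw [← ofReal_norm, ENNReal.ofReal_pow (norm_nonneg z)]

theorem exists_norm_fourierInv_le_inv_one_add_abs_pow {ψ : ℝ → ℂ} (hψ : ContDiff ℝ ∞ ψ)
    (hc : HasCompactSupport ψ) (N : ℕ) :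
    ∃ C : ℝ, ∀ τ, ‖𝓕⁻ ψ τ‖ ≤ C * ((1 + |τ|) ^ N)⁻¹ := by
  let Ψ : SchwartzMap ℝ ℂ := hc.toSchwartzMap hψ
  refine ⟨2 ^ N * (Finset.Iic (N, 0)).sup (fun m : ℕ × ℕ => SchwartzMap.seminorm ℝ m.1 m.2)
    (𝓕⁻ Ψ : SchwartzMap ℝ ℂ), fun τ => ?_⟩
  have hdecay := SchwartzMap.one_add_le_sup_seminorm_apply (𝕜 := ℝ) (m := (N, 0)) (k := N)
    (n := 0) le_rfl le_rfl (𝓕⁻ Ψ : SchwartzMap ℝ ℂ) τ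
  rw [norm_iteratedFDeriv_zero, SchwartzMap.fourierInv_coe, Real.norm_eq_abs] at hdecay
  rw [← div_eq_mul_inv, le_div_iff₀' (by positivity)]
  exact hdecay

theorem lintegral_comp_div_right {h : ℝ} (hh : 0 < h) (f : ℝ → ℝ≥0∞) :
    ∫⁻ t, f (t / h) = ENNReal.ofReal h * ∫⁻ t, f t := by
  let e : ℝ ≃ᵐ ℝ := MeasurableEquiv.mulRight₀ h⁻¹ (inv_ne_zero hh.ne')
  have hmap : Measure.map e volume = ENNReal.ofReal h • volume := by
    rw [MeasurableEquiv.coe_mulRight₀, Real.map_volume_mul_right (inv_ne_zero hh.ne'), inv_inv,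
      abs_of_pos hh]
  calc ∫⁻ t, f (t / h) = ∫⁻ t, f t ∂(Measure.map e volume) := by
        rw [lintegral_map_equiv]
        simp only [e, MeasurableEquiv.coe_mulRight₀, div_eq_mul_inv]
    _ = ENNReal.ofReal h * ∫⁻ t, f t := by rw [hmap, lintegral_smul_measure, smul_eq_mul]

theorem one_add_abs_le_two_mul_one_add_abs_add {u t : ℝ} (h : 2 * |u| ≤ |t|) :
    1 + |t| ≤ 2 * (1 + |u + t|) := by
  have htri := abs_sub_abs_le_abs_sub t (-u)
  rw [abs_neg, sub_neg_eq_add, add_comm t] at htri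
  linarith

variable {E : Type*} [NormedAddCommGroup E] [InnerProductSpace ℝ E] [FiniteDimensional ℝ E]
  [MeasurableSpace E] [BorelSpace E] {φ : ℝ → ℂ}

/-- The norm of the kernel with the weight `|t|^s |x|^{(d-1)/2-s}`, which is bounded uniformly and
in `L²` in time. -/
def weightedKernel (φ : ℝ → ℂ) (s t h : ℝ) (x : E) : ℝ :=
  |t| ^ s * ‖x‖ ^ (((finrank ℝ E : ℝ) - 1) / 2 - s) * ‖kernel φ t h x‖

theorem weightedKernel_nonneg (s t h : ℝ) (x : E) : 0 ≤ weightedKernel φ s t h x := by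
  unfold weightedKernel
  positivity

theorem weightedKernel_eq {h : ℝ} (hh : 0 < h) (s t : ℝ) (x : E) :
    weightedKernel φ s t h x =
      h ^ (-(((finrank ℝ E : ℝ) + 1) / 2)) * weightedKernel φ s (t / h) 1 (h⁻¹ • x) := by
  rw [weightedKernel, weightedKernel, norm_kernel_eq hh, abs_div, abs_of_pos hh, norm_smul,
    Real.norm_of_nonneg (inv_nonneg.2 hh.le), Real.div_rpow (abs_nonneg t) hh.le,
    Real.mul_rpow (inv_nonneg.2 hh.le) (norm_nonneg x), Real.inv_rpow hh.le]
  have hpow : h ^ s * h ^ (((finrank ℝ E : ℝ) - 1) / 2 - s) =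
      h ^ (-(((finrank ℝ E : ℝ) + 1) / 2)) * h ^ finrank ℝ E := by
    rw [← Real.rpow_natCast, ← Real.rpow_add hh, ← Real.rpow_add hh]
    ring_nf
  generalize h ^ (-(((finrank ℝ E : ℝ) + 1) / 2)) = H at hpow ⊢
  generalize ((finrank ℝ E : ℝ) - 1) / 2 - s = b at hpow ⊢
  generalize ‖kernel φ (t / h) 1 (h⁻¹ • x)‖ = K
  field_simp
  linear_combination |t| ^ s * ‖x‖ ^ b * K * hpow

variable [Nontrivial E]

theorem exists_norm_kernel_one_le_of_two_mul_norm_le (hφ : ContDiff ℝ ∞ φ)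
    (hc : HasCompactSupport φ) (hsupp : tsupport φ ⊆ Ioi 0) (N : ℕ) :
    ∃ C : ℝ, 0 ≤ C ∧ ∀ (t : ℝ) (x : E), 2 * ‖x‖ ≤ |t| →
      ‖kernel φ t 1 x‖ ≤ C * ((1 + |t|) ^ N)⁻¹ := by
  obtain ⟨C, hC⟩ := exists_norm_fourierInv_le_inv_one_add_abs_pow
    (contDiff_amplitude hφ (finrank ℝ E - 1)) (hasCompactSupport_amplitude hc _) N
  have hC0 : 0 ≤ C := by simpa using (norm_nonneg _).trans (hC 0)
  refine ⟨C * 2 ^ N * (volume : Measure E).toSphere.real univ, by positivity, fun t x hxt => ?_⟩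
  rw [kernel_eq_integral_sphere hφ.continuous hc hsupp]
  have hsphere (ν : sphere (0 : E) 1) :
      ‖𝓕⁻ (amplitude (finrank ℝ E - 1) φ) (inner ℝ ν.1 x + t)‖ ≤
        C * 2 ^ N * ((1 + |t|) ^ N)⁻¹ := by
    have hinner : |inner ℝ ν.1 x| ≤ ‖x‖ := by
      simpa only [norm_eq_of_mem_sphere ν, one_mul] using abs_real_inner_le_norm ν.1 x
    have hfar : 1 + |t| ≤ 2 * (1 + |inner ℝ ν.1 x + t|) :=
      one_add_abs_le_two_mul_one_add_abs_add (by linarith)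
    calc ‖𝓕⁻ (amplitude (finrank ℝ E - 1) φ) (inner ℝ ν.1 x + t)‖
        ≤ C * ((1 + |inner ℝ ν.1 x + t|) ^ N)⁻¹ := hC _
      _ = C * 2 ^ N * ((2 * (1 + |inner ℝ ν.1 x + t|)) ^ N)⁻¹ := by rw [mul_pow]; field_simp
      _ ≤ C * 2 ^ N * ((1 + |t|) ^ N)⁻¹ := by gcongr
  exact (norm_integral_le_of_norm_le_const (.of_forall hsphere)).trans_eq (mul_right_comm ..)

theorem exists_norm_kernel_le_of_two_mul_norm_le (hφ : ContDiff ℝ ∞ φ)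
    (hc : HasCompactSupport φ) (hsupp : tsupport φ ⊆ Ioi 0) (N : ℕ) :
    ∃ C : ℝ, 0 ≤ C ∧ ∀ (h t : ℝ) (x : E), 0 < h → 2 * ‖x‖ ≤ |t| →
      ‖kernel φ t h x‖ ≤ (h ^ finrank ℝ E)⁻¹ * (C * ((1 + |t| / h) ^ N)⁻¹) := by
  obtain ⟨C, hC0, hC⟩ :=
    exists_norm_kernel_one_le_of_two_mul_norm_le (E := E) hφ hc hsupp N
  refine ⟨C, hC0, fun h t x hh hxt => ?_⟩
  have hscaled := hC (t / h) (h⁻¹ • x) (by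
    rw [norm_smul, Real.norm_of_nonneg (by positivity), abs_div, abs_of_pos hh,
      inv_mul_eq_div, mul_div_assoc']
    gcongr)
  rw [abs_div, abs_of_pos hh] at hscaled
  rw [norm_kernel_eq hh]
  gcongr

theorem kernel_one_eq_fourierInv_profile (hφ : Continuous φ) (hc : HasCompactSupport φ)
    (hsupp : tsupport φ ⊆ Ioi 0) {x : E} (hx : x ≠ 0) :
    (fun t => kernel φ t 1 x) = 𝓕⁻ (profile φ (‖x‖⁻¹ • x) ‖x‖) := by
  ext t
  rw [← kernel_smul_eq_fourierInv_profile hφ hc hsupp,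
    smul_inv_smul₀ (norm_ne_zero_iff.2 hx)]

theorem exists_norm_rpow_mul_norm_kernel_one_le (hφ : ContDiff ℝ ∞ φ) (hc : HasCompactSupport φ)
    (hsupp : tsupport φ ⊆ Ioi 0) :
    ∃ C : ℝ, 0 ≤ C ∧ ∀ (t : ℝ) (x : E),
      ‖x‖ ^ (((finrank ℝ E : ℝ) - 1) / 2) * ‖kernel φ t 1 x‖ ≤ C := by
  obtain ⟨C, hC0, hC⟩ := exists_norm_kernel_one_le_of_two_mul_norm_le (E := E) hφ hc hsupp 0
  obtain ⟨g, hg, hgc, hg0, hprofile⟩ := exists_norm_profile_le (E := E) hφ.continuous hc hsupp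
  have hint0 : 0 ≤ ∫ r, g r := integral_nonneg hg0
  refine ⟨C + ∫ r, g r, by positivity, fun t x => ?_⟩
  rcases eq_or_ne x 0 with rfl | hx
  · have h0 := hC t 0 (by simp)
    rw [pow_zero, inv_one, mul_one] at h0
    calc _ ≤ 1 * C := mul_le_mul (by rw [norm_zero]; exact Real.zero_rpow_le_one _) h0
          (norm_nonneg _) zero_le_one
      _ ≤ C + ∫ r, g r := by linarith
  have hx0 : 0 < ‖x‖ := norm_pos_iff.2 hx
  have hkernel := congr_fun (kernel_one_eq_fourierInv_profile hφ.continuous hc hsupp hx) t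
  have hbound : ‖kernel φ t 1 x‖ ≤ ‖x‖ ^ (-(((finrank ℝ E : ℝ) - 1) / 2)) * ∫ r, g r := by
    rw [hkernel, Real.fourierInv_eq, ← integral_const_mul]
    refine norm_integral_le_of_norm_le ((hg.integrable_of_hasCompactSupport hgc).const_mul _)
      (.of_forall fun r => ?_)
    rw [Circle.norm_smul]
    exact hprofile _ _ r (norm_smul_inv_norm hx) hx0
  rw [Real.rpow_neg hx0.le, inv_mul_eq_div, le_div_iff₀' (by positivity)] at hbound
  linarith

theorem exists_norm_rpow_mul_eLpNorm_kernel_one_le (hφ : Continuous φ)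
    (hc : HasCompactSupport φ) (hsupp : tsupport φ ⊆ Ioi 0) :
    ∃ C : ℝ≥0∞, C ≠ ⊤ ∧ ∀ x : E, x ≠ 0 →
      eLpNorm (fun t => ‖x‖ ^ (((finrank ℝ E : ℝ) - 1) / 2) * ‖kernel φ t 1 x‖) 2 ≤ C := by
  obtain ⟨g, hg, hgc, hg0, hprofile⟩ := exists_norm_profile_le (E := E) hφ hc hsupp
  refine ⟨eLpNorm g 2, (hg.memLp_of_hasCompactSupport hgc).eLpNorm_ne_top, fun x hx => ?_⟩
  have hx0 : 0 < ‖x‖ := norm_pos_iff.2 hx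
  have he : ‖‖x‖⁻¹ • x‖ = 1 := norm_smul_inv_norm hx
  have hweight := eLpNorm_const_smul (‖x‖ ^ (((finrank ℝ E : ℝ) - 1) / 2))
    (fun t => ‖kernel φ t 1 x‖) 2 volume
  rw [eLpNorm_norm, kernel_one_eq_fourierInv_profile hφ hc hsupp hx, eLpNorm_fourierInv_eq
    (memLp_profile hφ hc he _ 1) (memLp_profile hφ hc he _ 2), ← eLpNorm_const_smul] at hweight
  refine hweight.trans_le (eLpNorm_mono fun r => ?_)
  rw [Pi.smul_apply, norm_smul, Real.norm_of_nonneg (by positivity), Real.norm_of_nonneg (hg0 r)]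
  refine (mul_le_mul_of_nonneg_left (hprofile _ _ r he hx0) (by positivity)).trans_eq ?_
  rw [Real.rpow_neg hx0.le, mul_inv_cancel_left₀ (by positivity)]

theorem exists_weightedKernel_one_le_add (hφ : ContDiff ℝ ∞ φ) (hc : HasCompactSupport φ)
    (hsupp : tsupport φ ⊆ Ioi 0) {s : ℝ} (hs0 : 0 ≤ s) (hs : s ≤ ((finrank ℝ E : ℝ) - 1) / 2) :
    ∃ C : ℝ, 0 ≤ C ∧ ∀ (t : ℝ) (x : E), weightedKernel φ s t 1 x ≤
      2 ^ s * (‖x‖ ^ (((finrank ℝ E : ℝ) - 1) / 2) * ‖kernel φ t 1 x‖) + C * (1 + |t|)⁻¹ := by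
  obtain ⟨C, hC0, hC⟩ :=
    exists_norm_kernel_one_le_of_two_mul_norm_le (E := E) hφ hc hsupp (finrank ℝ E)
  let a : ℝ := ((finrank ℝ E : ℝ) - 1) / 2
  have has : 0 ≤ a - s := sub_nonneg.2 hs
  refine ⟨C, hC0, fun t x => ?_⟩
  change |t| ^ s * ‖x‖ ^ (a - s) * ‖kernel φ t 1 x‖ ≤ 2 ^ s * (‖x‖ ^ a * _) + _
  rcases le_or_gt (2 * ‖x‖) |t| with hx | hx
  · refine le_add_of_nonneg_of_le (by positivity) ?_
    have ha : a ≤ (finrank ℝ E : ℝ) - 1 :=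
      half_le_self (sub_nonneg.2 (Nat.one_le_cast.2 finrank_pos))
    have hweight : |t| ^ s * ‖x‖ ^ (a - s) ≤ (1 + |t|) ^ ((finrank ℝ E : ℝ) - 1) :=
      calc |t| ^ s * ‖x‖ ^ (a - s) ≤ (1 + |t|) ^ s * (1 + |t|) ^ (a - s) := by
            gcongr <;> linarith [norm_nonneg x]
        _ = (1 + |t|) ^ a := by
            rw [← Real.rpow_add (by positivity), add_sub_cancel]
        _ ≤ (1 + |t|) ^ ((finrank ℝ E : ℝ) - 1) :=
            Real.rpow_le_rpow_of_exponent_le (by linarith [abs_nonneg t]) ha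
    calc |t| ^ s * ‖x‖ ^ (a - s) * ‖kernel φ t 1 x‖
        ≤ (1 + |t|) ^ ((finrank ℝ E : ℝ) - 1) * (C * ((1 + |t|) ^ finrank ℝ E)⁻¹) :=
          mul_le_mul hweight (hC t x hx) (norm_nonneg _) (by positivity)
      _ = C * (1 + |t|)⁻¹ := by
          rw [Real.rpow_sub_one (by positivity), Real.rpow_natCast]
          field_simp
  · refine le_add_of_le_of_nonneg ?_ (by positivity)
    calc |t| ^ s * ‖x‖ ^ (a - s) * ‖kernel φ t 1 x‖
        ≤ (2 * ‖x‖) ^ s * ‖x‖ ^ (a - s) * ‖kernel φ t 1 x‖ := by gcongr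
      _ = 2 ^ s * (‖x‖ ^ a * ‖kernel φ t 1 x‖) := by
          rw [Real.mul_rpow zero_le_two (norm_nonneg x), mul_assoc (2 ^ s),
            ← Real.rpow_add_of_nonneg (norm_nonneg x) hs0 has, add_sub_cancel, mul_assoc]

theorem exists_weightedKernel_le (hφ : ContDiff ℝ ∞ φ) (hc : HasCompactSupport φ)
    (hsupp : tsupport φ ⊆ Ioi 0) {s : ℝ} (hs0 : 0 ≤ s) (hs : s ≤ ((finrank ℝ E : ℝ) - 1) / 2) :
    ∃ C : ℝ, 0 ≤ C ∧ ∀ (h t : ℝ) (x : E), 0 < h →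
      weightedKernel φ s t h x ≤ C * h ^ (-(((finrank ℝ E : ℝ) + 1) / 2)) := by
  obtain ⟨C₁, hC₁0, hC₁⟩ := exists_norm_rpow_mul_norm_kernel_one_le (E := E) hφ hc hsupp
  obtain ⟨C₂, hC₂0, hC₂⟩ := exists_weightedKernel_one_le_add (E := E) hφ hc hsupp hs0 hs
  refine ⟨2 ^ s * C₁ + C₂, by positivity, fun h t x hh => ?_⟩
  rw [weightedKernel_eq hh, mul_comm]
  gcongr
  refine (hC₂ (t / h) (h⁻¹ • x)).trans ?_
  gcongr
  · exact hC₁ _ _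
  · exact mul_le_of_le_one_right hC₂0 (inv_le_one_of_one_le₀ (by linarith [abs_nonneg (t / h)]))

theorem memLp_inv_one_add_abs : MemLp (fun t : ℝ => (1 + |t|)⁻¹) 2 := by
  have hcont : Continuous fun t : ℝ => (1 + |t|)⁻¹ :=
    (by fun_prop : Continuous fun t : ℝ => 1 + |t|).inv₀ fun t => by positivity
  refine (memLp_two_iff_integrable_sq hcont.aestronglyMeasurable).2 ?_
  refine integrable_inv_one_add_sq.mono' (hcont.pow 2).aestronglyMeasurable
    (.of_forall fun t => ?_)
  rw [Real.norm_of_nonneg (by positivity), inv_pow]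
  gcongr
  nlinarith [sq_abs t, abs_nonneg t]

theorem exists_eLpNorm_weightedKernel_one_le (hφ : ContDiff ℝ ∞ φ) (hc : HasCompactSupport φ)
    (hsupp : tsupport φ ⊆ Ioi 0) {s : ℝ} (hs0 : 0 ≤ s) (hs : s ≤ ((finrank ℝ E : ℝ) - 1) / 2) :
    ∃ C : ℝ≥0∞, C ≠ ⊤ ∧ ∀ x : E, x ≠ 0 →
      eLpNorm (fun t => weightedKernel φ s t 1 x) 2 ≤ C := by
  obtain ⟨C₁, hC₁top, hC₁⟩ :=
    exists_norm_rpow_mul_eLpNorm_kernel_one_le (E := E) hφ.continuous hc hsupp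
  obtain ⟨C₂, -, hC₂⟩ := exists_weightedKernel_one_le_add (E := E) hφ hc hsupp hs0 hs
  let v (t : ℝ) : ℝ := (1 + |t|)⁻¹
  have hv : MemLp v 2 := memLp_inv_one_add_abs
  refine ⟨‖(2 : ℝ) ^ s‖ₑ * C₁ + ‖C₂‖ₑ * eLpNorm v 2, ?_, fun x hx => ?_⟩
  · have := hv.eLpNorm_ne_top
    finiteness
  let u (t : ℝ) : ℝ := ‖x‖ ^ (((finrank ℝ E : ℝ) - 1) / 2) * ‖kernel φ t 1 x‖
  have hcont : Continuous fun t => kernel φ t 1 x :=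
    (continuous_kernel hφ.continuous hc one_pos).comp (f := fun t => (t, x)) (by fun_prop)
  have hu : Continuous u := continuous_const.mul hcont.norm
  have hsum : eLpNorm (fun t => weightedKernel φ s t 1 x) 2 ≤
      eLpNorm ((2 : ℝ) ^ s • u + C₂ • v) 2 :=
    eLpNorm_mono_real fun t => by
      rw [Real.norm_of_nonneg (weightedKernel_nonneg ..)]
      exact hC₂ t x
  refine hsum.trans ((eLpNorm_add_le (hu.aestronglyMeasurable.const_smul _) (hv.1.const_smul _)
    one_le_two).trans ?_)
  rw [eLpNorm_const_smul, eLpNorm_const_smul]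
  gcongr
  exact hC₁ x hx

theorem exists_lintegral_weightedKernel_sq_le (hφ : ContDiff ℝ ∞ φ) (hc : HasCompactSupport φ)
    (hsupp : tsupport φ ⊆ Ioi 0) {s : ℝ} (hs0 : 0 ≤ s) (hs : s ≤ ((finrank ℝ E : ℝ) - 1) / 2) :
    ∃ C : ℝ≥0∞, C ≠ ⊤ ∧ ∀ (h : ℝ) (x : E), 0 < h → x ≠ 0 →
      ∫⁻ t, ENNReal.ofReal (weightedKernel φ s t h x ^ 2) ≤
        C * ENNReal.ofReal (h ^ (-(finrank ℝ E : ℝ))) := by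
  obtain ⟨C, hC, hunit⟩ := exists_eLpNorm_weightedKernel_one_le (E := E) hφ hc hsupp hs0 hs
  refine ⟨C ^ 2, by finiteness, fun h x hh hx => ?_⟩
  have hunit_sq : ∫⁻ t, ENNReal.ofReal (weightedKernel φ s t 1 (h⁻¹ • x) ^ 2) ≤ C ^ 2 := by
    have hnorm := eLpNorm_nnreal_pow_eq_lintegral (μ := volume) (p := 2)
      (f := fun t => weightedKernel φ s t 1 (h⁻¹ • x)) two_ne_zero
    simp only [NNReal.coe_ofNat, ENNReal.coe_ofNat, ENNReal.rpow_ofNat, enorm_sq_eq_ofReal,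
      Real.norm_eq_abs, sq_abs] at hnorm
    rw [← hnorm]
    gcongr
    exact hunit _ (smul_ne_zero (inv_ne_zero hh.ne') hx)
  have hpow : (h ^ (-(((finrank ℝ E : ℝ) + 1) / 2))) ^ 2 * h = h ^ (-(finrank ℝ E : ℝ)) := by
    rw [← Real.rpow_mul_natCast hh.le, ← Real.rpow_add_one hh.ne']
    congr 1
    push_cast
    ring
  calc ∫⁻ t, ENNReal.ofReal (weightedKernel φ s t h x ^ 2)
      = ENNReal.ofReal ((h ^ (-(((finrank ℝ E : ℝ) + 1) / 2))) ^ 2) *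
          (ENNReal.ofReal h * ∫⁻ t, ENNReal.ofReal (weightedKernel φ s t 1 (h⁻¹ • x) ^ 2)) := by
        rw [← lintegral_comp_div_right hh, ← lintegral_const_mul' _ _ ENNReal.ofReal_ne_top]
        congr 1 with t
        rw [weightedKernel_eq hh, mul_pow, ENNReal.ofReal_mul (by positivity)]
    _ ≤ ENNReal.ofReal ((h ^ (-(((finrank ℝ E : ℝ) + 1) / 2))) ^ 2) *
          (ENNReal.ofReal h * C ^ 2) := by gcongr
    _ = C ^ 2 * ENNReal.ofReal (h ^ (-(finrank ℝ E : ℝ))) := by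
        rw [← hpow, ENNReal.ofReal_mul (by positivity), ← mul_assoc, mul_comm]

end KernelBounds

section Bracket

open Metric Set Module

section Normed

variable {V : Type*} [NormedAddCommGroup V]

theorem bracket_pos (x : V) : 0 < bracket x :=
  one_pos.trans_le (one_le_bracket x)

theorem bracket_rpow_nonneg (x : V) (a : ℝ) : 0 ≤ bracket x ^ a :=
  Real.rpow_nonneg (bracket_pos x).le a

theorem bracket_rpow_neg_le_one (x : V) {a : ℝ} (ha : 0 ≤ a) : bracket x ^ (-a) ≤ 1 :=
  Real.rpow_le_one_of_one_le_of_nonpos (one_le_bracket x) (neg_nonpos.2 ha)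

theorem bracket_rpow (x : V) (a : ℝ) : bracket x ^ a = (1 + ‖x‖ ^ 2) ^ (a / 2) := by
  rw [bracket, Real.sqrt_eq_rpow, ← Real.rpow_mul (by positivity), one_div_mul_eq_div]

theorem continuous_bracket_rpow (a : ℝ) : Continuous fun x : V => bracket x ^ a := by
  refine Continuous.rpow_const ?_ fun x => Or.inl (bracket_pos x).ne'
  unfold bracket
  fun_prop

theorem bracket_le_one_add_norm (x : V) : bracket x ≤ 1 + ‖x‖ := by
  rw [bracket, Real.sqrt_le_left (by positivity)]
  nlinarith [norm_nonneg x]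

theorem norm_rpow_le_bracket_rpow {z : V} (hz : 1 ≤ ‖z‖) {q : ℝ} (hq : q ≤ 0) :
    ‖z‖ ^ q ≤ 2 ^ (-q / 2) * bracket z ^ q :=
  calc ‖z‖ ^ q = (‖z‖ ^ 2) ^ (q / 2) := by
        rw [← Real.rpow_natCast_mul (norm_nonneg z), Nat.cast_two, mul_div_cancel₀ _ two_ne_zero]
    _ ≤ ((1 + ‖z‖ ^ 2) / 2) ^ (q / 2) :=
        Real.rpow_le_rpow_of_nonpos (by positivity) (by nlinarith) (by linarith)
    _ = 2 ^ (-q / 2) * bracket z ^ q := by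
        rw [bracket_rpow, Real.div_rpow (by positivity) zero_le_two, neg_div,
          Real.rpow_neg zero_le_two, inv_mul_eq_div]

theorem bracket_rpow_mul_bracket_rpow_le (x z : V) {w q : ℝ} (hw : 0 ≤ w) (hq : q ≤ 0) :
    bracket x ^ (-w) * bracket z ^ q ≤ bracket x ^ (-(w - q)) + bracket z ^ (-(w - q)) := by
  have hsplit (y : V) : bracket y ^ (-(w - q)) = bracket y ^ (-w) * bracket y ^ q := by
    rw [← Real.rpow_add (bracket_pos y), neg_sub', sub_neg_eq_add]
  rcases le_total (bracket x) (bracket z) with h | h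
  · refine le_add_of_le_of_nonneg ?_ (bracket_rpow_nonneg z _)
    rw [hsplit]
    exact mul_le_mul_of_nonneg_left (Real.rpow_le_rpow_of_nonpos (bracket_pos x) h hq)
      (bracket_rpow_nonneg x _)
  · refine le_add_of_nonneg_of_le (bracket_rpow_nonneg x _) ?_
    rw [hsplit]
    exact mul_le_mul_of_nonneg_right
      (Real.rpow_le_rpow_of_nonpos (bracket_pos z) h (neg_nonpos.2 hw)) (bracket_rpow_nonneg z _)

theorem bracket_rpow_mul_norm_rpow_le (x z : V) {w q : ℝ} (hw : 0 ≤ w) (hq : q ≤ 0) :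
    bracket x ^ (-w) * ‖z‖ ^ q ≤ (ball 0 1).indicator (fun z => ‖z‖ ^ q) z +
      2 ^ (-q / 2) * bracket x ^ (-(w - q)) + 2 ^ (-q / 2) * bracket z ^ (-(w - q)) := by
  have hx := bracket_rpow_nonneg x (-(w - q))
  have hz := bracket_rpow_nonneg z (-(w - q))
  rcases lt_or_ge ‖z‖ 1 with hz1 | hz1
  · rw [indicator_of_mem (mem_ball_zero_iff.2 hz1), add_assoc]
    exact le_add_of_le_of_nonneg
      (mul_le_of_le_one_left (by positivity) (bracket_rpow_neg_le_one x hw)) (by positivity)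
  · rw [indicator_of_notMem (by rwa [mem_ball_zero_iff, not_lt]), zero_add]
    calc bracket x ^ (-w) * ‖z‖ ^ q
        ≤ bracket x ^ (-w) * (2 ^ (-q / 2) * bracket z ^ q) :=
          mul_le_mul_of_nonneg_left (norm_rpow_le_bracket_rpow hz1 hq) (bracket_rpow_nonneg x _)
      _ = 2 ^ (-q / 2) * (bracket x ^ (-w) * bracket z ^ q) := mul_left_comm ..
      _ ≤ 2 ^ (-q / 2) * (bracket x ^ (-(w - q)) + bracket z ^ (-(w - q))) := by
          gcongr
          exact bracket_rpow_mul_bracket_rpow_le x z hw hq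
      _ = _ := mul_add ..

end Normed

variable {E : Type*} [NormedAddCommGroup E] [InnerProductSpace ℝ E] [FiniteDimensional ℝ E]
  [MeasurableSpace E] [BorelSpace E]

theorem integrable_bracket_rpow {r : ℝ} (hr : finrank ℝ E < r) :
    Integrable fun x : E => bracket x ^ (-r) := by
  simp only [bracket_rpow]
  exact integrable_rpow_neg_one_add_norm_sq hr

theorem integrableOn_ball_norm_rpow [Nontrivial E] {q : ℝ} (hq : -((finrank ℝ E : ℝ) - 1) ≤ q) :
    IntegrableOn (fun x : E => ‖x‖ ^ q) (ball 0 1) := by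
  rw [integrableOn_fun_norm_addHaar (E := E) (μ := volume) (f := fun y : ℝ => y ^ q)]
  refine Measure.integrableOn_of_bounded (M := 1) measure_Ioo_lt_top.ne
    (Measurable.aestronglyMeasurable (by simp only [smul_eq_mul]; fun_prop)) ?_
  filter_upwards [ae_restrict_mem measurableSet_Ioo] with y ⟨hy0, hy1⟩
  rw [smul_eq_mul, ← Real.rpow_natCast, ← Real.rpow_add hy0, Nat.cast_pred finrank_pos,
    Real.norm_of_nonneg (by positivity)]
  exact Real.rpow_le_one hy0.le hy1.le (by linarith)

theorem exists_lintegral_bracket_mul_norm_rpow_le [Nontrivial E] {w q : ℝ} (hw : 0 ≤ w)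
    (hq0 : q ≤ 0) (hq : -((finrank ℝ E : ℝ) - 1) ≤ q) (hwq : finrank ℝ E < w - q) :
    ∃ C : ℝ≥0∞, C ≠ ⊤ ∧ ∀ y : E,
      ∫⁻ x : E, ENNReal.ofReal (bracket x ^ (-w) * ‖x - y‖ ^ q) ≤ C := by
  let F : E → ℝ := (ball 0 1).indicator fun z => ‖z‖ ^ q
  let G (z : E) : ℝ := 2 ^ (-q / 2) * bracket z ^ (-(w - q))
  have hF : Integrable F := (integrableOn_ball_norm_rpow hq).integrable_indicator
    measurableSet_ball
  have hG : Integrable G := (integrable_bracket_rpow hwq).const_mul _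
  have hF0 (z : E) : 0 ≤ F z := indicator_nonneg (fun z _ => by positivity) z
  have hG0 (z : E) : 0 ≤ G z := mul_nonneg (by positivity) (bracket_rpow_nonneg z _)
  refine ⟨ENNReal.ofReal (∫ z, (F z + G z + G z)), ENNReal.ofReal_ne_top, fun y => ?_⟩
  have hFy : Integrable fun x => F (x - y) := hF.comp_sub_right y
  have hGy : Integrable fun x => G (x - y) := hG.comp_sub_right y
  have hsum : ∫ x, (F (x - y) + G x + G (x - y)) = ∫ z, (F z + G z + G z) := by
    rw [integral_add (hFy.fun_add hG) hGy, integral_add hFy hG, integral_add (hF.fun_add hG) hG,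
      integral_add hF hG, integral_sub_right_eq_self F, integral_sub_right_eq_self G]
  rw [← hsum, ofReal_integral_eq_lintegral_ofReal ((hFy.fun_add hG).fun_add hGy)
    (.of_forall fun x => add_nonneg (add_nonneg (hF0 _) (hG0 _)) (hG0 _))]
  exact lintegral_mono fun x => ENNReal.ofReal_le_ofReal
    (bracket_rpow_mul_norm_rpow_le x (x - y) hw hq0)

end Bracket

section Operators

open Set

variable {n : ℕ} {φ : ℝ → ℂ} {A : Set (Eucl n)} {a h M : ℝ}

theorem wave_ae_eq (hφ : Continuous φ) (hc : HasCompactSupport φ) (hh : 0 < h) (t : ℝ)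
    (f : LpR n 2) :
    wave n φ hφ hc t h f =ᵐ[volume] fun x => ∫ y, kernel φ t h (x - y) * f y :=
  fourierMul_ae_eq_convolution _ (memLp_symbol_of_pos hφ hc hh t 1)
    (memLp_symbol_of_pos hφ hc hh t 2) f

theorem weight_ae_eq (ha : 0 ≤ a) (f : LpR n 2) :
    weight n a ha f =ᵐ[volume] fun x => ((bracket x ^ (-a) : ℝ) : ℂ) * f x :=
  mulOp_ae_eq _ f

theorem norm_mulOp_apply_le {m : Eucl n → ℂ} (hm : MemLp m ∞) (hM : ∀ x, ‖m x‖ ≤ M)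
    (f : LpR n 2) : ‖mulOp m hm f‖ ≤ M * ‖f‖ := by
  refine Lp.norm_le_mul_norm_of_ae_le_mul ?_
  filter_upwards [mulOp_ae_eq hm f] with x hx
  rw [hx, norm_mul]
  gcongr
  exact hM x

theorem mulOp_comm {m₁ m₂ : Eucl n → ℂ} (h₁ : MemLp m₁ ∞) (h₂ : MemLp m₂ ∞) (f : LpR n 2) :
    mulOp m₁ h₁ (mulOp m₂ h₂ f) = mulOp m₂ h₂ (mulOp m₁ h₁ f) := by
  refine Lp.ext ?_
  filter_upwards [mulOp_ae_eq h₁ (mulOp m₂ h₂ f), mulOp_ae_eq h₂ f,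
    mulOp_ae_eq h₂ (mulOp m₁ h₁ f), mulOp_ae_eq h₁ f] with x e₁ e₂ e₃ e₄
  rw [e₁, e₂, e₃, e₄, mul_left_comm]

theorem norm_bracket_rpow (x : Eucl n) (a : ℝ) :
    ‖((bracket x ^ a : ℝ) : ℂ)‖ = bracket x ^ a := by
  rw [Complex.norm_real, Real.norm_of_nonneg (bracket_rpow_nonneg x a)]

theorem norm_weight_apply_le (ha : 0 ≤ a) (f : LpR n 2) : ‖weight n a ha f‖ ≤ ‖f‖ := by
  rw [← one_mul ‖f‖]
  exact norm_mulOp_apply_le _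
    (fun x => (norm_bracket_rpow x _).trans_le (bracket_rpow_neg_le_one x ha)) f

theorem norm_wave_apply_le (hφ : Continuous φ) (hc : HasCompactSupport φ) (hM : ∀ r, ‖φ r‖ ≤ M)
    (t h : ℝ) (f : LpR n 2) : ‖wave n φ hφ hc t h f‖ ≤ M * ‖f‖ := by
  let ℱ := Lp.fourierTransformₗᵢ (Eucl n) ℂ
  have hmul := norm_mulOp_apply_le
    (memLp_symbol n (measurable_waveFun hφ t h) (bounded_waveFun hφ hc t h))
    (fun ξ => (norm_symbol t h ξ).trans_le (hM _)) (ℱ f)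
  rw [ℱ.norm_map] at hmul
  exact (ℱ.symm.norm_map _).trans_le hmul

theorem memLp_indicator_one (hA : MeasurableSet A) : MemLp (A.indicator fun _ => (1 : ℂ)) ∞ :=
  memLp_top_of_bound (measurable_const.indicator hA).aestronglyMeasurable 1 <| .of_forall
    fun x => (norm_indicator_le_norm_self _ x).trans_eq norm_one

/-- Multiplication by the indicator function of `A` on `L²(ℝⁿ)`. -/
def cutoff (hA : MeasurableSet A) : LpR n 2 →L[ℂ] LpR n 2 :=
  mulOp _ (memLp_indicator_one hA)

theorem cutoff_ae_eq (hA : MeasurableSet A) (f : LpR n 2) :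
    cutoff hA f =ᵐ[volume] A.indicator f := by
  filter_upwards [mulOp_ae_eq (memLp_indicator_one hA) f] with x hx
  rw [cutoff, hx, ← indicator_mul_left]
  simp only [one_mul]

theorem cutoff_add_cutoff_compl (hA : MeasurableSet A) (f : LpR n 2) :
    cutoff hA f + cutoff hA.compl f = f := by
  refine Lp.ext ?_
  filter_upwards [Lp.coeFn_add (cutoff hA f) (cutoff hA.compl f), cutoff_ae_eq hA f,
    cutoff_ae_eq hA.compl f] with x hadd hin hout
  rw [hadd, Pi.add_apply, hin, hout, ← Pi.add_apply, indicator_self_add_compl]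

theorem norm_cutoff_apply_le (hA : MeasurableSet A) (f : LpR n 2) : ‖cutoff hA f‖ ≤ ‖f‖ := by
  refine Lp.norm_le_norm_of_ae_le ?_
  filter_upwards [cutoff_ae_eq hA f] with x hx
  rw [hx]
  exact norm_indicator_le_norm_self _ _

theorem norm_cutoff_weight_apply_le (hA : MeasurableSet A) (ha : 0 ≤ a) (f : LpR n 2) :
    ‖cutoff hA (weight n a ha f)‖ ≤ ‖cutoff hA f‖ := by
  rw [cutoff, weight, mulOp_comm]
  exact norm_weight_apply_le ha _

end Operators

section LocalDecay

open Metric Set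

variable {n : ℕ} {φ : ℝ → ℂ} {a h κ s t R : ℝ}

theorem bracket_rpow_neg_le_of_abs_div_four_le {V : Type*} [NormedAddCommGroup V] {x : V}
    (hx : |t| / 4 ≤ ‖x‖) (ha : 0 ≤ a) : bracket x ^ (-a) ≤ 4 ^ a * bracket t ^ (-a) := by
  have hle : bracket t / 4 ≤ bracket x := by
    refine Real.le_sqrt_of_sq_le ?_
    rw [div_pow, bracket, Real.sq_sqrt (by positivity), Real.norm_eq_abs]
    nlinarith [abs_nonneg t]
  refine (Real.rpow_le_rpow_of_nonpos (div_pos (bracket_pos t) four_pos) hle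
    (neg_nonpos.2 ha)).trans_eq ?_
  rw [Real.div_rpow (bracket_pos t).le zero_le_four, Real.rpow_neg zero_le_four, div_inv_eq_mul,
    mul_comm]

theorem norm_cutoff_compl_ball_weight_apply_le (ha : 0 ≤ a) (t : ℝ) (f : LpR n 2) :
    ‖cutoff (measurableSet_ball (x := (0 : Eucl n)) (ε := |t| / 4)).compl (weight n a ha f)‖ ≤
      4 ^ a * bracket t ^ (-a) * ‖f‖ := by
  refine Lp.norm_le_mul_norm_of_ae_le_mul ?_
  filter_upwards [cutoff_ae_eq (measurableSet_ball (x := (0 : Eucl n)) (ε := |t| / 4)).compl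
    (weight n a ha f), weight_ae_eq ha f] with x hcut hweight
  rw [hcut]
  by_cases hx : x ∈ (ball (0 : Eucl n) (|t| / 4))ᶜ
  · rw [indicator_of_mem hx, hweight, norm_mul, norm_bracket_rpow]
    gcongr
    exact bracket_rpow_neg_le_of_abs_div_four_le (by simpa using hx) ha
  · rw [indicator_of_notMem hx, norm_zero]
    exact mul_nonneg (mul_nonneg (by positivity) (bracket_rpow_nonneg t _)) (norm_nonneg _)

theorem sq_lintegral_mul_le {α : Type*} [MeasurableSpace α] {μ : Measure α} {f g : α → ℝ≥0∞}
    (hf : AEMeasurable f μ) (hg : AEMeasurable g μ) :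
    (∫⁻ x, f x * g x ∂μ) ^ 2 ≤ (∫⁻ x, f x ^ 2 ∂μ) * ∫⁻ x, g x ^ 2 ∂μ := by
  have hHolder := pow_le_pow_left'
    (ENNReal.lintegral_mul_le_Lp_mul_Lq μ Real.HolderConjugate.two_two hf hg) 2
  simpa only [Pi.mul_apply, ENNReal.rpow_ofNat, mul_pow, ← ENNReal.rpow_mul_natCast,
    Nat.cast_ofNat, one_div, inv_mul_cancel₀ (two_ne_zero (α := ℝ)), ENNReal.rpow_one] using hHolder

theorem enorm_integral_mul_sq_le {α : Type*} [MeasurableSpace α] {μ : Measure α} {k g : α → ℂ}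
    (hk : AEStronglyMeasurable k μ) (hg : AEStronglyMeasurable g μ) :
    ‖∫ y, k y * g y ∂μ‖ₑ ^ 2 ≤ (∫⁻ y, ‖k y‖ₑ ^ 2 ∂μ) * ∫⁻ y, ‖g y‖ₑ ^ 2 ∂μ := by
  refine (pow_le_pow_left' (enorm_integral_le_lintegral_enorm _) 2).trans ?_
  simp only [enorm_mul]
  exact sq_lintegral_mul_le hk.enorm hg.enorm

theorem norm_le_mul_norm_of_lintegral_sq_le {α : Type*} [MeasurableSpace α] {μ : Measure α}
    {f g : Lp ℂ 2 μ} {c : ℝ} (hc : 0 ≤ c)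
    (h : ∫⁻ x, ‖f x‖ₑ ^ 2 ∂μ ≤ ENNReal.ofReal c ^ 2 * ∫⁻ x, ‖g x‖ₑ ^ 2 ∂μ) : ‖f‖ ≤ c * ‖g‖ := by
  rw [← eLpNorm_two_sq, ← eLpNorm_two_sq, ← mul_pow,
    ENNReal.pow_le_pow_left_iff two_ne_zero] at h
  rw [Lp.norm_def, Lp.norm_def, ← ENNReal.toReal_ofReal hc, ← ENNReal.toReal_mul]
  exact ENNReal.toReal_mono (ENNReal.mul_ne_top ENNReal.ofReal_ne_top (Lp.eLpNorm_ne_top g)) h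

theorem norm_cutoff_ball_wave_cutoff_ball_le (hφ : Continuous φ) (hc : HasCompactSupport φ)
    (hh : 0 < h) (hκ0 : 0 ≤ κ) (hκ : ∀ z : Eucl n, ‖z‖ ≤ 2 * R → ‖kernel φ t h z‖ ≤ κ)
    (g : LpR n 2) :
    ‖cutoff (measurableSet_ball (x := (0 : Eucl n)) (ε := R)) (wave n φ hφ hc t h
      (cutoff (measurableSet_ball (x := (0 : Eucl n)) (ε := R)) g))‖ ≤
      κ * volume.real (ball (0 : Eucl n) R) * ‖g‖ := by
  set B := ball (0 : Eucl n) R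
  have hB : MeasurableSet B := measurableSet_ball
  have hBtop : volume B ≠ ⊤ := measure_ball_lt_top.ne
  have hpointwise (x : Eucl n) (hx : x ∈ B) : ‖∫ y in B, kernel φ t h (x - y) * g y‖ₑ ^ 2 ≤
      ENNReal.ofReal κ ^ 2 * volume B * ∫⁻ y, ‖g y‖ₑ ^ 2 := by
    have hk : Continuous fun y => kernel φ t h (x - y) :=
      (continuous_kernel hφ hc hh).comp (f := fun y => (t, x - y)) (by fun_prop)
    refine (enorm_integral_mul_sq_le hk.aestronglyMeasurable
      (Lp.aestronglyMeasurable g).restrict).trans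
      (mul_le_mul' ?_ (setLIntegral_le_lintegral B _))
    rw [← setLIntegral_const]
    refine setLIntegral_mono measurable_const fun y hy => pow_le_pow_left' ?_ 2
    rw [← ofReal_norm]
    refine ENNReal.ofReal_le_ofReal (hκ _ ?_)
    rw [mem_ball_zero_iff] at hx hy
    linarith [norm_sub_le x y]
  have hae : ∀ᵐ x, ‖cutoff hB (wave n φ hφ hc t h (cutoff hB g)) x‖ₑ ^ 2 ≤
      B.indicator (fun _ => ENNReal.ofReal κ ^ 2 * volume B * ∫⁻ y, ‖g y‖ₑ ^ 2) x := by
    filter_upwards [cutoff_ae_eq hB (wave n φ hφ hc t h (cutoff hB g)),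
      wave_ae_eq hφ hc hh t (cutoff hB g)] with x hcut hwave
    rw [hcut]
    by_cases hx : x ∈ B
    · rw [indicator_of_mem hx, indicator_of_mem hx, hwave]
      refine le_of_eq_of_le ?_ (hpointwise x hx)
      rw [← integral_indicator hB]
      congr 2
      refine integral_congr_ae ?_
      filter_upwards [cutoff_ae_eq hB g] with y hy
      rw [hy, indicator_mul_right]
    · simp [hx]
  refine norm_le_mul_norm_of_lintegral_sq_le (mul_nonneg hκ0 measureReal_nonneg)
    ((lintegral_mono_ae hae).trans_eq ?_)
  rw [lintegral_indicator hB, setLIntegral_const, ENNReal.ofReal_mul hκ0, ofReal_measureReal hBtop]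
  ring

theorem abs_div_four_pow_mul_le (n : ℕ) (hs0 : 0 ≤ s) (hh : 0 < h) (hh1 : h ≤ 1) (t : ℝ) :
    (|t| / 4) ^ n * ((h ^ n)⁻¹ * ((1 + |t| / h) ^ (n + ⌈s⌉₊))⁻¹) ≤ bracket t ^ (-s) := by
  have hth : |t| ≤ |t| / h := le_div_self (abs_nonneg t) hh hh1
  have hz : 0 ≤ |t| / h := by positivity
  have hscale : (|t| / 4) ^ n * (h ^ n)⁻¹ ≤ (1 + |t| / h) ^ n := by
    rw [← div_eq_mul_inv, ← div_pow, div_right_comm]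
    gcongr
    linarith
  have hbracket : bracket t ^ s ≤ (1 + |t| / h) ^ ⌈s⌉₊ := by
    rw [← Real.rpow_natCast]
    calc bracket t ^ s ≤ (1 + |t| / h) ^ s := Real.rpow_le_rpow (bracket_pos t).le
          ((bracket_le_one_add_norm t).trans (by rw [Real.norm_eq_abs]; linarith)) hs0
      _ ≤ (1 + |t| / h) ^ (⌈s⌉₊ : ℝ) :=
          Real.rpow_le_rpow_of_exponent_le (by linarith) (Nat.le_ceil s)
  have hb := Real.rpow_pos_of_pos (bracket_pos t) s
  calc (|t| / 4) ^ n * ((h ^ n)⁻¹ * ((1 + |t| / h) ^ (n + ⌈s⌉₊))⁻¹)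
      = (|t| / 4) ^ n * (h ^ n)⁻¹ * (((1 + |t| / h) ^ n)⁻¹ * ((1 + |t| / h) ^ ⌈s⌉₊)⁻¹) := by
        rw [pow_add, mul_inv, mul_assoc]
    _ ≤ (1 + |t| / h) ^ n * (((1 + |t| / h) ^ n)⁻¹ * (bracket t ^ s)⁻¹) := by gcongr
    _ = bracket t ^ (-s) := by
        rw [Real.rpow_neg (bracket_pos t).le, mul_inv_cancel_left₀ (by positivity)]

theorem exists_norm_cutoff_ball_wave_cutoff_ball_le [NeZero n] (hφ : ContDiff ℝ ∞ φ)
    (hc : HasCompactSupport φ) (hsupp : tsupport φ ⊆ Ioi 0) (hs0 : 0 ≤ s) :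
    ∃ C, 0 ≤ C ∧ ∀ h t, 0 < h → h ≤ 1 → ∀ g : LpR n 2,
      ‖cutoff (measurableSet_ball (x := (0 : Eucl n)) (ε := |t| / 4))
        (wave n φ hφ.continuous hc t h
          (cutoff (measurableSet_ball (x := (0 : Eucl n)) (ε := |t| / 4)) g))‖ ≤
        C * bracket t ^ (-s) * ‖g‖ := by
  obtain ⟨C, hC0, hC⟩ := exists_norm_kernel_le_of_two_mul_norm_le (E := Eucl n) hφ hc hsupp
    (n + ⌈s⌉₊)
  let V := volume.real (ball (0 : Eucl n) 1)
  refine ⟨C * V, mul_nonneg hC0 measureReal_nonneg, fun h t hh hh1 g => ?_⟩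
  have hball : volume.real (ball (0 : Eucl n) (|t| / 4)) = (|t| / 4) ^ n * V := by
    rw [measureReal_def, Measure.addHaar_ball _ _ (by positivity), finrank_euclideanSpace_fin,
      ENNReal.toReal_mul, ENNReal.toReal_ofReal (by positivity), ← measureReal_def]
  refine (norm_cutoff_ball_wave_cutoff_ball_le hφ.continuous hc hh (by positivity)
    (fun z hz => hC h t z hh (by linarith)) g).trans
    (mul_le_mul_of_nonneg_right ?_ (norm_nonneg g))
  rw [hball, finrank_euclideanSpace_fin]
  calc (h ^ n)⁻¹ * (C * ((1 + |t| / h) ^ (n + ⌈s⌉₊))⁻¹) * ((|t| / 4) ^ n * V)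
      = C * V * ((|t| / 4) ^ n * ((h ^ n)⁻¹ * ((1 + |t| / h) ^ (n + ⌈s⌉₊))⁻¹)) := by ring
    _ ≤ C * V * bracket t ^ (-s) := mul_le_mul_of_nonneg_left
        (abs_div_four_pow_mul_le n hs0 hh hh1 t) (mul_nonneg hC0 measureReal_nonneg)

theorem exists_norm_weight_wave_weight_le [NeZero n] (hφ : ContDiff ℝ ∞ φ)
    (hc : HasCompactSupport φ) (hsupp : tsupport φ ⊆ Ioi 0) (hs0 : 0 ≤ s) :
    ∃ C, 0 ≤ C ∧ ∀ h t, 0 < h → h ≤ 1 →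
      ‖weight n s hs0 ∘L wave n φ hφ.continuous hc t h ∘L weight n s hs0‖ ≤
        C * bracket t ^ (-s) := by
  obtain ⟨M, hM⟩ := hφ.continuous.bounded_above_of_compact_support hc
  have hM0 : 0 ≤ M := (norm_nonneg _).trans (hM 0)
  obtain ⟨C, hC0, hC⟩ := exists_norm_cutoff_ball_wave_cutoff_ball_le (n := n) hφ hc hsupp hs0
  refine ⟨2 * M * 4 ^ s + C, by positivity, fun h t hh hh1 => ?_⟩
  have hb := bracket_rpow_nonneg t (-s)
  refine ContinuousLinearMap.opNorm_le_bound _ (by positivity) fun f => ?_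
  let W := weight n s hs0
  let T := wave n φ hφ.continuous hc t h
  have hB := measurableSet_ball (x := (0 : Eucl n)) (ε := |t| / 4)
  let χ := cutoff hB
  let χc := cutoff hB.compl
  have hW (u) : ‖W u‖ ≤ ‖u‖ := norm_weight_apply_le hs0 u
  have hT (u) : ‖T u‖ ≤ M * ‖u‖ := norm_wave_apply_le hφ.continuous hc hM t h u
  have hfar (u) : ‖χc (W u)‖ ≤ 4 ^ s * bracket t ^ (-s) * ‖u‖ :=
    norm_cutoff_compl_ball_weight_apply_le hs0 t u
  have hdecomp : W (T (W f)) = W (T (χc (W f))) + (χc (W (T (χ (W f)))) + χ (W (T (χ (W f))))) := by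
    rw [add_comm (χc _), cutoff_add_cutoff_compl, ← map_add, ← map_add, add_comm,
      cutoff_add_cutoff_compl]
  have hfar_right : ‖W (T (χc (W f)))‖ ≤ M * (4 ^ s * bracket t ^ (-s) * ‖f‖) :=
    (hW _).trans ((hT _).trans (by gcongr; exact hfar f))
  have hfar_left : ‖χc (W (T (χ (W f))))‖ ≤ 4 ^ s * bracket t ^ (-s) * (M * ‖f‖) := by
    refine (hfar _).trans ?_
    gcongr
    exact (hT _).trans (by gcongr; exact (norm_cutoff_apply_le hB _).trans (hW f))
  have hnear : ‖χ (W (T (χ (W f))))‖ ≤ C * bracket t ^ (-s) * ‖f‖ := by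
    refine (norm_cutoff_weight_apply_le hB hs0 _).trans ((hC h t hh hh1 (W f)).trans ?_)
    gcongr
    exact hW f
  calc ‖W (T (W f))‖
      ≤ M * (4 ^ s * bracket t ^ (-s) * ‖f‖) +
          (4 ^ s * bracket t ^ (-s) * (M * ‖f‖) + C * bracket t ^ (-s) * ‖f‖) := by
        rw [hdecomp]
        exact norm_add_le_of_le hfar_right (norm_add_le_of_le hfar_left hnear)
    _ = (2 * M * 4 ^ s + C) * bracket t ^ (-s) * ‖f‖ := by ring

end LocalDecay

section Dispersive

open Module
open scoped BoundedContinuousFunction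

section Convolution

variable {G : Type*} [SeminormedAddCommGroup G] [MeasurableSpace G] {μ : Measure G}

theorem norm_bcf_mul_le (k : G →ᵇ ℂ) (f : Lp ℂ 1 μ) (x y : G) :
    ‖k (x - y) * f y‖ ≤ ‖k‖ * ‖f y‖ := by
  rw [norm_mul]
  gcongr
  exact k.norm_coe_le_norm _

theorem norm_integral_bcf_mul_le (k : G →ᵇ ℂ) (f : Lp ℂ 1 μ) (x : G) :
    ‖∫ y, k (x - y) * f y ∂μ‖ ≤ ‖k‖ * ‖f‖ := by
  rw [L1.norm_eq_integral_norm, ← integral_const_mul]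
  exact norm_integral_le_of_norm_le ((L1.integrable_coeFn f).norm.const_mul _)
    (.of_forall (norm_bcf_mul_le k f x))

variable [BorelSpace G]

theorem integrable_bcf_mul (k : G →ᵇ ℂ) (f : Lp ℂ 1 μ) (x : G) :
    Integrable (fun y => k (x - y) * f y) μ :=
  (L1.integrable_coeFn f).bdd_mul (k.continuous.comp (continuous_sub_left x)).aestronglyMeasurable
    (.of_forall fun y => k.norm_coe_le_norm (x - y))

theorem memLp_top_integral_bcf_mul (k : G →ᵇ ℂ) (f : Lp ℂ 1 μ) :
    MemLp (fun x => ∫ y, k (x - y) * f y ∂μ) ⊤ μ := by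
  have hcont : Continuous fun x => ∫ y, k (x - y) * f y ∂μ :=
    continuous_of_dominated (fun x => (integrable_bcf_mul k f x).1)
      (fun x => .of_forall (norm_bcf_mul_le k f x)) ((L1.integrable_coeFn f).norm.const_mul _)
      (.of_forall fun y => (k.continuous.comp (continuous_sub_right y)).mul continuous_const)
  exact memLp_top_of_bound hcont.aestronglyMeasurable _
    (.of_forall (norm_integral_bcf_mul_le k f))

/-- Convolution with a bounded continuous kernel, as an operator `L¹ → L^∞`. -/
def convOp (μ : Measure G) (k : G →ᵇ ℂ) : Lp ℂ 1 μ →L[ℂ] Lp ℂ ⊤ μ :=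
  LinearMap.mkContinuous
    { toFun := fun f => (memLp_top_integral_bcf_mul k f).toLp _
      map_add' := fun f g => by
        rw [← MemLp.toLp_add]
        refine MemLp.toLp_congr _ _ (.of_forall fun x => ?_)
        rw [Pi.add_apply, ← integral_add (integrable_bcf_mul k f x) (integrable_bcf_mul k g x)]
        refine integral_congr_ae ?_
        filter_upwards [Lp.coeFn_add f g] with y hy
        rw [hy, Pi.add_apply, mul_add]
      map_smul' := fun c f => by
        rw [RingHom.id_apply, ← MemLp.toLp_const_smul]
        refine MemLp.toLp_congr _ _ (.of_forall fun x => ?_)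
        rw [Pi.smul_apply, ← integral_smul]
        refine integral_congr_ae ?_
        filter_upwards [Lp.coeFn_smul c f] with y hy
        rw [hy, Pi.smul_apply, mul_smul_comm] }
    ‖k‖ fun f => by
      refine (Lp.norm_toLp _ (memLp_top_integral_bcf_mul k f)).trans_le
        (ENNReal.toReal_le_of_le_ofReal (by positivity) ?_)
      rw [eLpNorm_exponent_top]
      exact eLpNormEssSup_le_of_ae_bound (.of_forall (norm_integral_bcf_mul_le k f))

theorem convOp_ae_eq (k : G →ᵇ ℂ) (f : Lp ℂ 1 μ) :
    convOp μ k f =ᵐ[μ] fun x => ∫ y, k (x - y) * f y ∂μ :=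
  (memLp_top_integral_bcf_mul k f).coeFn_toLp

theorem norm_convOp_le (k : G →ᵇ ℂ) : ‖convOp μ k‖ ≤ ‖k‖ :=
  LinearMap.mkContinuous_norm_le _ (norm_nonneg k) _

end Convolution

variable {n : ℕ} {φ : ℝ → ℂ} {h : ℝ}

theorem norm_kernel_le_integral {E : Type*} [NormedAddCommGroup E] [InnerProductSpace ℝ E]
    [FiniteDimensional ℝ E] [MeasurableSpace E] [BorelSpace E] (t h : ℝ) (x : E) :
    ‖kernel φ t h x‖ ≤ ∫ ξ : E, ‖symbol φ t h ξ‖ := by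
  rw [kernel, Real.fourierInv_eq]
  refine (norm_integral_le_integral_norm _).trans_eq ?_
  simp only [Circle.norm_smul]

/-- The kernel of `e^{it√G₀} φ(h√G₀)` as a bounded continuous function. -/
def kernelBCF (n : ℕ) (hφ : Continuous φ) (hc : HasCompactSupport φ) (hh : 0 < h) (t : ℝ) :
    Eucl n →ᵇ ℂ :=
  .ofNormedAddCommGroup (kernel φ t h) (continuous_fourierInv (integrable_symbol hφ hc hh t)) _
    (norm_kernel_le_integral t h)

/-- The extension of `e^{it√G₀} φ(h√G₀)` to an operator `L¹ → L^∞`. -/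
def waveL1 (n : ℕ) (hφ : Continuous φ) (hc : HasCompactSupport φ) (hh : 0 < h) (t : ℝ) :
    LpR n 1 →L[ℂ] LpR n ⊤ :=
  convOp volume (kernelBCF n hφ hc hh t)

theorem waveL1_ae_eq (hφ : Continuous φ) (hc : HasCompactSupport φ) (hh : 0 < h) (t : ℝ)
    (f : LpR n 1) :
    waveL1 n hφ hc hh t f =ᵐ[volume] fun x => ∫ y, kernel φ t h (x - y) * f y :=
  convOp_ae_eq _ f

theorem isExtension_waveL1 (hφ : Continuous φ) (hc : HasCompactSupport φ) (hh : 0 < h) (t : ℝ) :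
    IsExtension (wave n φ hφ hc t h) (waveL1 n hφ hc hh t) := by
  intro f h1 h2
  filter_upwards [waveL1_ae_eq hφ hc hh t (h1.toLp f), wave_ae_eq hφ hc hh t (h2.toLp f)]
    with x hL1 hL2
  rw [hL1, hL2]
  refine integral_congr_ae ?_
  filter_upwards [h1.coeFn_toLp, h2.coeFn_toLp] with y hy1 hy2
  rw [hy1, hy2]

theorem exists_norm_waveL1_le [NeZero n] (hφ : ContDiff ℝ ∞ φ) (hc : HasCompactSupport φ)
    (hsupp : tsupport φ ⊆ Set.Ioi 0) :
    ∃ C, 0 ≤ C ∧ ∀ h t (hh : 0 < h), t ≠ 0 →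
      ‖waveL1 n hφ.continuous hc hh t‖ ≤
        C * h ^ (-(((n : ℝ) + 1) / 2)) * |t| ^ (-(((n : ℝ) - 1) / 2)) := by
  have hn : 0 ≤ ((n : ℝ) - 1) / 2 := by
    linarith [Nat.one_le_cast (α := ℝ).2 (NeZero.one_le (n := n))]
  obtain ⟨C, hC0, hC⟩ := exists_weightedKernel_le (E := Eucl n) hφ hc hsupp hn
    (by rw [finrank_euclideanSpace_fin])
  refine ⟨C, hC0, fun h t hh ht => (norm_convOp_le _).trans
    ((BoundedContinuousFunction.norm_le (by positivity)).2 fun x => ?_)⟩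
  have hx := hC h t x hh
  rw [weightedKernel, finrank_euclideanSpace_fin, sub_self, Real.rpow_zero, mul_one] at hx
  rwa [Real.rpow_neg (abs_nonneg t), ← div_eq_mul_inv,
    le_div_iff₀' (Real.rpow_pos_of_pos (abs_pos.2 ht) _)]

end Dispersive

section WeightedDispersive

open Set Module

section MixedNorm

variable {α β : Type*} [MeasurableSpace α] [MeasurableSpace β]

theorem enorm_integral_mul_sq_le_lintegral_withDensity {ν : Measure β} {k f : β → ℂ}
    (hk : Measurable k) (hf : AEStronglyMeasurable f ν) :
    ‖∫ y, k y * f y ∂ν‖ₑ ^ 2 ≤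
      (∫⁻ y, ‖k y‖ₑ ^ 2 ∂ν.withDensity (‖f ·‖ₑ)) * ∫⁻ y, ‖f y‖ₑ ∂ν := by
  have hdensity : ∫⁻ y, ‖k y * f y‖ₑ ∂ν = ∫⁻ y, ‖k y‖ₑ * 1 ∂ν.withDensity (‖f ·‖ₑ) := by
    rw [lintegral_withDensity_eq_lintegral_mul₀ hf.enorm (by fun_prop)]
    simp only [enorm_mul, mul_one, Pi.mul_apply, mul_comm]
  have hmass : ∫⁻ _, 1 ^ 2 ∂ν.withDensity (‖f ·‖ₑ) = ∫⁻ y, ‖f y‖ₑ ∂ν := by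
    rw [one_pow, lintegral_one, withDensity_apply _ .univ, Measure.restrict_univ]
  rw [← hmass]
  refine (pow_le_pow_left' ((enorm_integral_le_lintegral_enorm _).trans_eq hdensity) 2).trans ?_
  exact sq_lintegral_mul_le hk.enorm.aemeasurable aemeasurable_const

theorem lintegral_enorm_integral_mul_sq_le {μ : Measure α} {ν : Measure β} [SFinite μ] [SFinite ν]
    {K : α → β → ℂ} (hK : Measurable K.uncurry) {D : ℝ≥0∞}
    (hD : ∀ y, ∫⁻ z, ‖K z y‖ₑ ^ 2 ∂μ ≤ D) {f : β → ℂ} (hf : AEStronglyMeasurable f ν) :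
    ∫⁻ z, ‖∫ y, K z y * f y ∂ν‖ₑ ^ 2 ∂μ ≤ D * (∫⁻ y, ‖f y‖ₑ ∂ν) ^ 2 := by
  have hKsq : Measurable (Function.uncurry fun z y => ‖K z y‖ₑ ^ 2) := hK.enorm.pow_const 2
  have hmass : ν.withDensity (‖f ·‖ₑ) univ = ∫⁻ y, ‖f y‖ₑ ∂ν := by
    rw [withDensity_apply _ .univ, Measure.restrict_univ]
  calc ∫⁻ z, ‖∫ y, K z y * f y ∂ν‖ₑ ^ 2 ∂μ
      ≤ ∫⁻ z, (∫⁻ y, ‖K z y‖ₑ ^ 2 ∂ν.withDensity (‖f ·‖ₑ)) * ∫⁻ y, ‖f y‖ₑ ∂ν ∂μ :=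
        lintegral_mono fun z => enorm_integral_mul_sq_le_lintegral_withDensity
          (hK.comp measurable_prodMk_left) hf
    _ = (∫⁻ y, ∫⁻ z, ‖K z y‖ₑ ^ 2 ∂μ ∂ν.withDensity (‖f ·‖ₑ)) * ∫⁻ y, ‖f y‖ₑ ∂ν := by
        rw [lintegral_mul_const _ hKsq.lintegral_prod_right,
          lintegral_lintegral_swap hKsq.aemeasurable]
    _ ≤ (∫⁻ _, D ∂ν.withDensity (‖f ·‖ₑ)) * ∫⁻ y, ‖f y‖ₑ ∂ν := by
        gcongr with y
        exact hD y
    _ = D * (∫⁻ y, ‖f y‖ₑ ∂ν) ^ 2 := by rw [lintegral_const, hmass, mul_assoc, sq]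

end MixedNorm

section Kernel

variable {E : Type*} [NormedAddCommGroup E] [InnerProductSpace ℝ E] [FiniteDimensional ℝ E]
  [MeasurableSpace E] [BorelSpace E] {φ : ℝ → ℂ} {a s : ℝ}

theorem ofReal_mul_enorm_bracket_mul_kernel_sq (a s t h : ℝ) (x : E) {z : E} (hz : z ≠ 0) :
    ENNReal.ofReal (|t| ^ (2 * s)) * ‖((bracket x ^ (-a) : ℝ) : ℂ) * kernel φ t h z‖ₑ ^ 2 =
      ENNReal.ofReal (weightedKernel φ s t h z ^ 2) *
        ENNReal.ofReal (bracket x ^ (-(2 * a)) * ‖z‖ ^ (2 * s - ((finrank ℝ E : ℝ) - 1))) := by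
  have ht : |t| ^ (2 * s) = (|t| ^ s) ^ 2 := by
    rw [mul_comm, ← Nat.cast_two (R := ℝ), Real.rpow_mul_natCast (abs_nonneg t)]
  have hx : bracket x ^ (-(2 * a)) = (bracket x ^ (-a)) ^ 2 := by
    rw [← Real.rpow_mul_natCast (bracket_pos x).le, Nat.cast_two, neg_mul, mul_comm]
  have hzpow : (‖z‖ ^ (((finrank ℝ E : ℝ) - 1) / 2 - s)) ^ 2 *
      ‖z‖ ^ (2 * s - ((finrank ℝ E : ℝ) - 1)) = 1 := by
    rw [← Real.rpow_mul_natCast (norm_nonneg z), ← Real.rpow_add (norm_pos_iff.2 hz)]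
    convert Real.rpow_zero ‖z‖ using 2
    push_cast
    ring
  rw [enorm_sq_eq_ofReal, ← ENNReal.ofReal_mul (by positivity), ← ENNReal.ofReal_mul (sq_nonneg _),
    norm_mul, Complex.norm_real, mul_pow, Real.norm_eq_abs, sq_abs, ht, hx, weightedKernel, mul_pow,
    mul_pow]
  congr 1
  linear_combination -((|t| ^ s) ^ 2 * (bracket x ^ (-a)) ^ 2 * ‖kernel φ t h z‖ ^ 2) * hzpow

theorem continuous_bracket_mul_kernel {X : Type*} [TopologicalSpace X] (hφ : Continuous φ)
    (hc : HasCompactSupport φ) {h : ℝ} (hh : 0 < h) (a : ℝ) {τ : X → ℝ} {u v : X → E}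
    (hτ : Continuous τ) (hu : Continuous u) (hv : Continuous v) :
    Continuous fun p => ((bracket (u p) ^ (-a) : ℝ) : ℂ) * kernel φ (τ p) h (v p) := by
  have hk : Continuous fun p => kernel φ (τ p) h (v p) :=
    (continuous_kernel hφ hc hh).comp (f := fun p => (τ p, v p)) (hτ.prodMk hv)
  exact (Complex.continuous_ofReal.comp ((continuous_bracket_rpow (-a)).comp hu)).mul hk

variable [Nontrivial E]

theorem exists_lintegral_bracket_mul_kernel_sq_le (hφ : ContDiff ℝ ∞ φ) (hc : HasCompactSupport φ)
    (hsupp : tsupport φ ⊆ Ioi 0) (hs0 : 0 ≤ s) (hs : s ≤ ((finrank ℝ E : ℝ) - 1) / 2)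
    (ha : 1 / 2 + s < a) :
    ∃ C : ℝ≥0∞, C ≠ ⊤ ∧ ∀ (h t : ℝ) (x : E), 0 < h →
      ENNReal.ofReal (|t| ^ (2 * s)) *
          ∫⁻ y, ‖((bracket y ^ (-a) : ℝ) : ℂ) * kernel φ t h (x - y)‖ₑ ^ 2 ≤
        C * ENNReal.ofReal (h ^ (-(((finrank ℝ E : ℝ) + 1) / 2))) ^ 2 := by
  obtain ⟨C₁, -, hC₁⟩ := exists_weightedKernel_le (E := E) hφ hc hsupp hs0 hs
  obtain ⟨C₂, hC₂top, hC₂⟩ := exists_lintegral_bracket_mul_norm_rpow_le (E := E) (w := 2 * a)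
    (q := 2 * s - ((finrank ℝ E : ℝ) - 1)) (by linarith) (by linarith) (by linarith) (by linarith)
  refine ⟨ENNReal.ofReal (C₁ ^ 2) * C₂, ENNReal.mul_ne_top ENNReal.ofReal_ne_top hC₂top,
    fun h t x hh => ?_⟩
  set H := h ^ (-(((finrank ℝ E : ℝ) + 1) / 2))
  have hH : 0 ≤ H := by positivity
  rw [← lintegral_const_mul' _ _ ENNReal.ofReal_ne_top]
  calc ∫⁻ y, ENNReal.ofReal (|t| ^ (2 * s)) *
        ‖((bracket y ^ (-a) : ℝ) : ℂ) * kernel φ t h (x - y)‖ₑ ^ 2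
      ≤ ∫⁻ y, ENNReal.ofReal ((C₁ * H) ^ 2) * ENNReal.ofReal
          (bracket y ^ (-(2 * a)) * ‖y - x‖ ^ (2 * s - ((finrank ℝ E : ℝ) - 1))) := by
        refine lintegral_mono_ae ?_
        filter_upwards [Measure.ae_ne volume x] with y hy
        rw [ofReal_mul_enorm_bracket_mul_kernel_sq a s t h y (sub_ne_zero.2 hy.symm),
          norm_sub_rev x y]
        gcongr
        · exact weightedKernel_nonneg s t h (x - y)
        · exact hC₁ h t (x - y) hh
    _ ≤ ENNReal.ofReal ((C₁ * H) ^ 2) * C₂ := by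
        rw [lintegral_const_mul' _ _ ENNReal.ofReal_ne_top]
        gcongr
        exact hC₂ x
    _ = ENNReal.ofReal (C₁ ^ 2) * C₂ * ENNReal.ofReal H ^ 2 := by
        rw [mul_pow, ENNReal.ofReal_mul (sq_nonneg C₁), ENNReal.ofReal_pow hH]
        ring

theorem exists_lintegral_prod_bracket_mul_kernel_sq_le (hφ : ContDiff ℝ ∞ φ)
    (hc : HasCompactSupport φ) (hsupp : tsupport φ ⊆ Ioi 0) (hs0 : 0 ≤ s)
    (hs : s ≤ ((finrank ℝ E : ℝ) - 1) / 2) (ha : 1 / 2 + s < a) :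
    ∃ C : ℝ≥0∞, C ≠ ⊤ ∧ ∀ (h : ℝ) (y : E), 0 < h →
      ∫⁻ p : ℝ × E, ENNReal.ofReal (|p.1| ^ (2 * s)) *
          ‖((bracket p.2 ^ (-a) : ℝ) : ℂ) * kernel φ p.1 h (p.2 - y)‖ₑ ^ 2 ≤
        C * ENNReal.ofReal (h ^ (-(finrank ℝ E : ℝ))) := by
  obtain ⟨C₁, hC₁top, hC₁⟩ := exists_lintegral_weightedKernel_sq_le (E := E) hφ hc hsupp hs0 hs
  obtain ⟨C₂, hC₂top, hC₂⟩ := exists_lintegral_bracket_mul_norm_rpow_le (E := E) (w := 2 * a)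
    (q := 2 * s - ((finrank ℝ E : ℝ) - 1)) (by linarith) (by linarith) (by linarith) (by linarith)
  refine ⟨C₁ * C₂, ENNReal.mul_ne_top hC₁top hC₂top, fun h y hh => ?_⟩
  have hmeas := (continuous_bracket_mul_kernel (τ := Prod.fst) (u := Prod.snd)
    (v := fun p : ℝ × E => p.2 - y) hφ.continuous hc hh a
    (by fun_prop) (by fun_prop) (by fun_prop)).measurable
  rw [Measure.volume_eq_prod, lintegral_prod_symm _ (by fun_prop)]
  calc ∫⁻ x, ∫⁻ t : ℝ, ENNReal.ofReal (|t| ^ (2 * s)) *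
        ‖((bracket x ^ (-a) : ℝ) : ℂ) * kernel φ t h (x - y)‖ₑ ^ 2
      ≤ ∫⁻ x, C₁ * ENNReal.ofReal (h ^ (-(finrank ℝ E : ℝ))) * ENNReal.ofReal
          (bracket x ^ (-(2 * a)) * ‖x - y‖ ^ (2 * s - ((finrank ℝ E : ℝ) - 1))) := by
        refine lintegral_mono_ae ?_
        filter_upwards [Measure.ae_ne volume y] with x hx
        have hz := sub_ne_zero.2 hx
        simp only [fun t => ofReal_mul_enorm_bracket_mul_kernel_sq (φ := φ) a s t h x hz]
        rw [lintegral_mul_const' _ _ ENNReal.ofReal_ne_top]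
        gcongr
        exact hC₁ h (x - y) hh hz
    _ ≤ C₁ * ENNReal.ofReal (h ^ (-(finrank ℝ E : ℝ))) * C₂ := by
        rw [lintegral_const_mul' _ _ (ENNReal.mul_ne_top hC₁top ENNReal.ofReal_ne_top)]
        gcongr
        exact hC₂ y
    _ = C₁ * C₂ * ENNReal.ofReal (h ^ (-(finrank ℝ E : ℝ))) := mul_right_comm ..

end Kernel

section Operators

variable {n : ℕ} [NeZero n] {φ : ℝ → ℂ} {a s : ℝ}

theorem exists_eLpNorm_wave_weight_le (hφ : ContDiff ℝ ∞ φ) (hc : HasCompactSupport φ)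
    (hsupp : tsupport φ ⊆ Ioi 0) (hs0 : 0 ≤ s) (hs : s ≤ ((n : ℝ) - 1) / 2)
    (ha : 1 / 2 + s < a) :
    ∃ C, 0 ≤ C ∧ ∀ h t, 0 < h → t ≠ 0 → ∀ f : LpR n 2,
      eLpNorm (wave n φ hφ.continuous hc t h (weight n a (by linarith) f)) ⊤ ≤
        ENNReal.ofReal (C * h ^ (-(((n : ℝ) + 1) / 2)) * |t| ^ (-s)) * eLpNorm f 2 := by
  obtain ⟨C, hCtop, hC⟩ := exists_lintegral_bracket_mul_kernel_sq_le (E := Eucl n) hφ hc hsupp hs0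
    (by rwa [finrank_euclideanSpace_fin]) ha
  rw [finrank_euclideanSpace_fin] at hC
  refine ⟨√C.toReal, Real.sqrt_nonneg _, fun h t hh ht f => ?_⟩
  have ha0 : 0 ≤ a := by linarith
  have hts : 0 < |t| ^ s := Real.rpow_pos_of_pos (abs_pos.2 ht) s
  have hsq : ENNReal.ofReal (√C.toReal * h ^ (-(((n : ℝ) + 1) / 2)) * |t| ^ (-s)) ^ 2 =
      C * ENNReal.ofReal (h ^ (-(((n : ℝ) + 1) / 2))) ^ 2 / ENNReal.ofReal (|t| ^ (2 * s)) := by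
    rw [mul_comm 2 s, ← Nat.cast_two (R := ℝ), Real.rpow_mul_natCast (abs_nonneg t),
      Real.rpow_neg (abs_nonneg t), ← div_eq_mul_inv, ← ENNReal.ofReal_pow (by positivity),
      ← ENNReal.ofReal_pow (by positivity), div_pow, mul_pow, Real.sq_sqrt ENNReal.toReal_nonneg,
      ENNReal.ofReal_div_of_pos (pow_pos hts 2), ENNReal.ofReal_mul ENNReal.toReal_nonneg,
      ENNReal.ofReal_toReal hCtop]
  rw [eLpNorm_exponent_top]
  refine eLpNormEssSup_le_of_ae_enorm_bound ?_
  filter_upwards [wave_ae_eq hφ.continuous hc hh t (weight n a ha0 f)] with x hx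
  have hweight : ∫ y, kernel φ t h (x - y) * weight n a ha0 f y =
      ∫ y, ((bracket y ^ (-a) : ℝ) : ℂ) * kernel φ t h (x - y) * f y := by
    refine integral_congr_ae ?_
    filter_upwards [weight_ae_eq ha0 f] with y hy
    rw [hy, mul_left_comm, mul_assoc]
  have hk : Continuous fun y => ((bracket y ^ (-a) : ℝ) : ℂ) * kernel φ t h (x - y) :=
    continuous_bracket_mul_kernel hφ.continuous hc hh a
      (by fun_prop) (by fun_prop) (by fun_prop)
  rw [← ENNReal.pow_le_pow_left_iff two_ne_zero, mul_pow, hsq, hx, hweight, eLpNorm_two_sq]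
  refine (enorm_integral_mul_sq_le hk.aestronglyMeasurable (Lp.aestronglyMeasurable f)).trans ?_
  gcongr
  rw [ENNReal.le_div_iff_mul_le (.inl (by positivity)) (.inl ENNReal.ofReal_ne_top), mul_comm]
  exact hC h t x hh

theorem enorm_abs_rpow_sq (t s : ℝ) :
    ‖((|t| ^ s : ℝ) : ℂ)‖ₑ ^ 2 = ENNReal.ofReal (|t| ^ (2 * s)) := by
  rw [enorm_sq_eq_ofReal, Complex.norm_real, Real.norm_eq_abs, sq_abs, mul_comm 2 s,
    ← Nat.cast_two (R := ℝ), Real.rpow_mul_natCast (abs_nonneg t)]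

theorem exists_lintegral_waveL1_le (hφ : ContDiff ℝ ∞ φ) (hc : HasCompactSupport φ)
    (hsupp : tsupport φ ⊆ Ioi 0) (hs0 : 0 ≤ s) (hs : s ≤ ((n : ℝ) - 1) / 2)
    (ha : 1 / 2 + s < a) :
    ∃ C, 0 ≤ C ∧ ∀ h (hh : 0 < h) (f : LpR n 1),
      ∫⁻ t : ℝ, ENNReal.ofReal (|t| ^ (2 * s)) * eLpNorm (fun x =>
          ((bracket x ^ (-a) : ℝ) : ℂ) * waveL1 n hφ.continuous hc hh t f x) 2 ^ 2 ≤
        ENNReal.ofReal (C * h ^ (-(n : ℝ))) * eLpNorm f 1 ^ 2 := by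
  obtain ⟨C, hCtop, hC⟩ := exists_lintegral_prod_bracket_mul_kernel_sq_le (E := Eucl n) hφ hc
    hsupp hs0 (by rwa [finrank_euclideanSpace_fin]) ha
  rw [finrank_euclideanSpace_fin] at hC
  refine ⟨C.toReal, ENNReal.toReal_nonneg, fun h hh f => ?_⟩
  rw [ENNReal.ofReal_mul ENNReal.toReal_nonneg, ENNReal.ofReal_toReal hCtop,
    eLpNorm_one_eq_lintegral_enorm]
  let K : ℝ × Eucl n → Eucl n → ℂ := fun p y =>
    ((|p.1| ^ s : ℝ) : ℂ) * (((bracket p.2 ^ (-a) : ℝ) : ℂ) * kernel φ p.1 h (p.2 - y))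
  have hK : Measurable K.uncurry :=
    Measurable.mul (by fun_prop) (continuous_bracket_mul_kernel
      (X := (ℝ × Eucl n) × Eucl n) hφ.continuous hc hh a
      (by fun_prop) (by fun_prop) (by fun_prop)).measurable
  have hKsq : ∀ p y, ‖K p y‖ₑ ^ 2 = ENNReal.ofReal (|p.1| ^ (2 * s)) *
      ‖((bracket p.2 ^ (-a) : ℝ) : ℂ) * kernel φ p.1 h (p.2 - y)‖ₑ ^ 2 := fun p y => by
    rw [enorm_mul, mul_pow, enorm_abs_rpow_sq]
  have hslice : ∀ t, ENNReal.ofReal (|t| ^ (2 * s)) * eLpNorm (fun x =>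
      ((bracket x ^ (-a) : ℝ) : ℂ) * waveL1 n hφ.continuous hc hh t f x) 2 ^ 2 =
        ∫⁻ x, ‖∫ y, K (t, x) y * f y‖ₑ ^ 2 := fun t => by
    rw [eLpNorm_two_sq, ← lintegral_const_mul' _ _ ENNReal.ofReal_ne_top]
    refine lintegral_congr_ae ?_
    filter_upwards [waveL1_ae_eq hφ.continuous hc hh t f] with x hx
    simp only [K, hx, mul_assoc, integral_const_mul]
    rw [enorm_mul _ (_ * _), mul_pow, enorm_abs_rpow_sq]
  have hmeas : AEMeasurable fun p => ‖∫ y, K p y * f y‖ₑ ^ 2 :=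
    ((hK.stronglyMeasurable.mul
      ((Lp.stronglyMeasurable f).comp_measurable measurable_snd)).integral_prod_right'
        (ν := volume)).enorm.pow_const 2 |>.aemeasurable
  simp only [hslice]
  rw [← lintegral_prod _ hmeas, ← Measure.volume_eq_prod]
  refine lintegral_enorm_integral_mul_sq_le hK (fun y => ?_) (Lp.aestronglyMeasurable f)
  simp only [hKsq]
  exact hC h y hh

end Operators

end WeightedDispersive

end FreeWave

end

theorem proposition2p1_general (n : ℕ) (φ : ℝ → ℂ) (hφ : ContDiff ℝ ∞ φ)
    (hc : HasCompactSupport φ) (hsupp : tsupport φ ⊆ Set.Ioi 0)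
    (s : ℝ) (hs0 : 0 ≤ s) (hs : s ≤ ((n : ℝ) - 1) / 2) (ε : ℝ) (hε : 0 < ε) :
    ∃ C : ℝ, 0 < C ∧ ∀ h : ℝ, 0 < h →
      (h ≤ 1 → ∀ t : ℝ,
        ‖FreeWave.weight n s hs0 ∘L FreeWave.wave n φ hφ.continuous hc t h ∘L
          FreeWave.weight n s hs0‖ ≤ C * FreeWave.bracket t ^ (-s)) ∧
      (∀ t : ℝ, t ≠ 0 → ∀ f : FreeWave.LpR n 2,
        eLpNorm (FreeWave.wave n φ hφ.continuous hc t h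
            (FreeWave.weight n (1 / 2 + s + ε) (by positivity) f)) ∞ volume
          ≤ ENNReal.ofReal (C * h ^ (-((n : ℝ) + 1) / 2) * |t| ^ (-s)) * eLpNorm f 2 volume) ∧
      ∃ U : ℝ → FreeWave.LpR n 1 →L[ℂ] FreeWave.LpR n ∞,
        (∀ t : ℝ, FreeWave.IsExtension (FreeWave.wave n φ hφ.continuous hc t h) (U t)) ∧
        (∀ t : ℝ, t ≠ 0 →
          ‖U t‖ ≤ C * h ^ (-((n : ℝ) + 1) / 2) * |t| ^ (-((n : ℝ) - 1) / 2)) ∧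
        (∀ f : FreeWave.LpR n 1,
          ∫⁻ t : ℝ, ENNReal.ofReal (|t| ^ (2 * s)) *
            eLpNorm (fun x => ((FreeWave.bracket x ^ (-(1 / 2 + s + ε)) : ℝ) : ℂ) * U t f x)
              2 volume ^ 2
            ≤ ENNReal.ofReal (C * h ^ (-(n : ℝ))) * eLpNorm f 1 volume ^ 2) := by
  have hn1 : (1 : ℝ) ≤ n := by linarith
  have : NeZero n := ⟨by rintro rfl; norm_num at hn1⟩
  have ha : 1 / 2 + s < 1 / 2 + s + ε := by linarith
  obtain ⟨C₁, hC₁0, hC₁⟩ := FreeWave.exists_norm_weight_wave_weight_le (n := n) hφ hc hsupp hs0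
  obtain ⟨C₂, hC₂0, hC₂⟩ := FreeWave.exists_eLpNorm_wave_weight_le hφ hc hsupp hs0 hs ha
  obtain ⟨C₃, hC₃0, hC₃⟩ := FreeWave.exists_norm_waveL1_le (n := n) hφ hc hsupp
  obtain ⟨C₄, hC₄0, hC₄⟩ := FreeWave.exists_lintegral_waveL1_le hφ hc hsupp hs0 hs ha
  simp only [neg_div]
  refine ⟨C₁ + C₂ + C₃ + C₄ + 1, by positivity, fun h hh => ⟨fun hh1 t => ?_, fun t ht f => ?_,
    FreeWave.waveL1 n hφ.continuous hc hh, FreeWave.isExtension_waveL1 hφ.continuous hc hh,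
    fun t ht => ?_, fun f => ?_⟩⟩
  · refine (hC₁ h t hh hh1).trans ?_
    gcongr
    · exact FreeWave.bracket_rpow_nonneg t _
    · linarith
  · refine (hC₂ h t hh ht f).trans ?_
    gcongr
    linarith
  · refine (hC₃ h t hh ht).trans ?_
    gcongr
    linarith
  · refine (hC₄ h hh f).trans ?_
    gcongr
    linarith

theorem proposition2p1 (n : ℕ) (hn : 2 ≤ n) (φ : ℝ → ℂ) (hφ : ContDiff ℝ ∞ φ)
    (hc : HasCompactSupport φ) (hsupp : tsupport φ ⊆ Set.Ioi 0)
    (s : ℝ) (hs0 : 0 ≤ s) (hs : s ≤ ((n : ℝ) - 1) / 2) (ε : ℝ) (hε : 0 < ε) :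
    ∃ C : ℝ, 0 < C ∧ ∀ h : ℝ, 0 < h → h ≤ 1 →
      (∀ t : ℝ,
        ‖FreeWave.weight n s hs0 ∘L FreeWave.wave n φ hφ.continuous hc t h ∘L
          FreeWave.weight n s hs0‖ ≤ C * FreeWave.bracket t ^ (-s)) ∧
      (∀ t : ℝ, t ≠ 0 → ∀ f : FreeWave.LpR n 2,
        eLpNorm (FreeWave.wave n φ hφ.continuous hc t h
            (FreeWave.weight n (1 / 2 + s + ε) (by positivity) f)) ∞ volume
          ≤ ENNReal.ofReal (C * h ^ (-((n : ℝ) + 1) / 2) * |t| ^ (-s)) * eLpNorm f 2 volume) ∧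
      ∃ U : ℝ → FreeWave.LpR n 1 →L[ℂ] FreeWave.LpR n ∞,
        (∀ t : ℝ, FreeWave.IsExtension (FreeWave.wave n φ hφ.continuous hc t h) (U t)) ∧
        (∀ t : ℝ, t ≠ 0 →
          ‖U t‖ ≤ C * h ^ (-((n : ℝ) + 1) / 2) * |t| ^ (-((n : ℝ) - 1) / 2)) ∧
        (∀ f : FreeWave.LpR n 1,
          ∫⁻ t : ℝ, ENNReal.ofReal (|t| ^ (2 * s)) *
            eLpNorm (fun x => ((FreeWave.bracket x ^ (-(1 / 2 + s + ε)) : ℝ) : ℂ) * U t f x)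
              2 volume ^ 2
            ≤ ENNReal.ofReal (C * h ^ (-(n : ℝ))) * eLpNorm f 1 volume ^ 2) := by
  obtain ⟨C, hC0, hC⟩ := proposition2p1_general n φ hφ hc hsupp s hs0 hs ε hε
  exact ⟨C, hC0, fun h hh hh1 => ⟨(hC h hh).1 hh1, (hC h hh).2⟩⟩
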